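/- Let $M=(|M|,\mathcal O_M)$ be a $\mathbb Z_2^n$-manifold: a second-countable Hausdorff space with a sheaf of $\mathbb Z_2^n$-graded, $\mathbb Z_2^n$-commutative ($st=(-1)^{\langle\deg s,\deg t\rangle}ts$, with $\langle\ ,\ \rangle$ the standard scalar product on $\mathbb Z_2^n$) associative unital $\mathbb R$-algebras with local stalks, locally isomorphic to $(\mathbb R^p, C^\infty(-)[[\xi]])$, where the finitely many formal variables $\xi^A$ have non-zero degrees in $\mathbb Z_2^n$ and $\xi^A\xi^B=(-1)^{\langle\deg \xi^A,\deg \xi^B\rangle}\xi^B\xi^A$. In local coordinates $x^I=(x^a,\xi^A)$ of degrees $\deg(I)$, differential forms are polynomials in symbols $\mathrm dx^I$ with coefficients in $\mathcal O_M$, subject to $x^I\,\mathrm dx^J=(-1)^{\langle\deg (I),\deg (J)\rangle}\mathrm dx^J\,x^I$ and $\mathrm dx^I\,\mathrm dx^J=-(-1)^{\langle\deg (I),\deg (J)\rangle}\mathrm dx^J\,\mathrm dx^I$, and transform by $\mathrm dx^{I'}=\mathrm dx^I\,\partial x^{I'}/\partial x^I$; one sets $\mathrm d=\mathrm dx^I\,\partial/\partial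 x^I$ and, for a vector field (graded derivation) $X=X^I\,\partial/\partial x^I$, $i_X=X^I\,\partial/\partial(\mathrm dx^I)$. Let $\omega$ be a symplectic structure of degree $\gamma\in\mathbb Z_2^n$ on $M$, i.e. a two-form $\omega=\tfrac12\,\mathrm dx^I\,\mathrm dx^J\,\omega_{JI}$ of $\mathbb Z_2^n$-degree $\gamma$ with $\mathrm d\omega=0$ whose matrix of components $(\omega_{JI})$ is invertible in every chart. Then for every function $f\in\mathcal O_M(|M|)$ there is a unique vector field $X_f$ with $i_{X_f}\omega=\mathrm df$, so that the Poisson bracket $$\{f,g\}_\omega:=X_f(g)=i_{X_f}i_{X_g}\omega$$ is well defined. It has degree $\gamma$: if $f,g$ are homogeneous, then $\{f,g\}_\omega$ is homogeneous of degree $\deg(f)+\deg(g)+\gamma$. It satisfies the $\gamma$-shifted $\mathbb Z_2^n$-graded Jacobi identity $$\{f,\{g,h\}_\omega\}_\omega=\{\{f,g\}_\omega,h\}_\omega+(-1)^{\langle\deg(f)+\gamma,\ \deg(g)+\gamma\rangle}\,\{g,\{f,h\}_\omega\}_\omega$$ for all homogeneous $f,g,h\in\mathcal O_M(|M|)$.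 -/

import Mathlib

universe u

noncomputable section

open CategoryTheory TopologicalSpace Opposite

namespace Z2nGeometry

/-! ## Signs -/

/-- The group `ℤ₂ⁿ`. -/
abbrev Deg (n : ℕ) : Type := Fin n → ZMod 2

/-- The commutation factor `(-1)^⟨a, b⟩`, where `⟨a, b⟩ = ∑ i, a i * b i` in `ℤ₂`. -/
def sgn {n : ℕ} (a b : Deg n) : ℤ := if a ⬝ᵥ b = 0 then 1 else -1

/-! ## Smooth functions on open subsets of `ℝ^p` -/

section Smooth

open scoped ContDiff

/-- Extension by zero of a function on `V` to the whole of `ℝ^p`. -/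
def extend {p : ℕ} {V : Opens (Fin p → ℝ)} (f : V → ℝ) : (Fin p → ℝ) → ℝ :=
  Function.extend ((↑) : V → (Fin p → ℝ)) f 0

theorem extend_apply {p : ℕ} {V : Opens (Fin p → ℝ)} (f : V → ℝ) (x : V) :
    extend f (x : Fin p → ℝ) = f x :=
  Subtype.val_injective.extend_apply f 0 x

/-- `C^∞(V)` for `V` open in `ℝ^p`. -/
def Smooth {p : ℕ} (V : Opens (Fin p → ℝ)) : Subalgebra ℝ (V → ℝ) where
  carrier := {f | ContDiffOn ℝ ∞ (extend f) (V : Set (Fin p → ℝ))}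
  mul_mem' {f g} hf hg := (ContDiffOn.mul hf hg).congr fun x hx => by
    simpa using extend_apply (f * g) ⟨x, hx⟩ |>.trans
      (congrArg₂ (· * ·) (extend_apply f ⟨x, hx⟩).symm (extend_apply g ⟨x, hx⟩).symm)
  add_mem' {f g} hf hg := (ContDiffOn.add hf hg).congr fun x hx => by
    simpa using extend_apply (f + g) ⟨x, hx⟩ |>.trans
      (congrArg₂ (· + ·) (extend_apply f ⟨x, hx⟩).symm (extend_apply g ⟨x, hx⟩).symm)
  algebraMap_mem' r := (contDiffOn_const (c := r)).congr fun x hx =>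
    extend_apply (algebraMap ℝ (V → ℝ) r) ⟨x, hx⟩

/-- The restriction `C^∞(V) → C^∞(V')` for `V' ⊆ V`. -/
def Smooth.restrict {p : ℕ} {V V' : Opens (Fin p → ℝ)} (h : V' ≤ V) (f : Smooth V) :
    Smooth V' :=
  ⟨fun x => f.1 ⟨x.1, h x.2⟩, (ContDiffOn.mono f.2 h).congr fun x hx =>
    (extend_apply _ (⟨x, hx⟩ : V')).trans (extend_apply f.1 ⟨x, h hx⟩).symm⟩

/-- The `a`-th standard coordinate function on `V`. -/
def Smooth.coord {p : ℕ} (V : Opens (Fin p → ℝ)) (a : Fin p) : Smooth V :=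
  ⟨fun x => x.1 a, (contDiff_apply ℝ ℝ a).contDiffOn.congr fun x hx =>
    extend_apply _ (⟨x, hx⟩ : V)⟩

/-- The partial derivative `∂/∂x^a` on `C^∞(V)`. -/
def Smooth.partialDeriv {p : ℕ} {V : Opens (Fin p → ℝ)} (a : Fin p) (f : Smooth V) : Smooth V :=
  ⟨fun x => fderiv ℝ (extend f.1) x.1 (Pi.single a 1),
    ((((contDiffOn_infty_iff_fderiv_of_isOpen V.2).1 f.2).2).clm_apply
      (contDiffOn_const (c := (Pi.single a (1 : ℝ) : Fin p → ℝ)))).congr fun x hx =>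
      extend_apply _ (⟨x, hx⟩ : V)⟩

end Smooth

/-! ## Formal power series in `ℤ₂ⁿ`-graded commuting variables -/

section Series

variable {n N : ℕ}

/-- The exponents of the monomials `ξ^α = ξ₁^{α₁} ⋯ ξ_N^{α_N}`: a variable of odd total degree
(`⟨deg ξ, deg ξ⟩ = 1`) squares to zero and so occurs at most once. -/
def Admissible (deg : Fin N → Deg n) (α : Fin N →₀ ℕ) : Prop :=
  ∀ A, deg A ⬝ᵥ deg A ≠ 0 → α A ≤ 1

/-- The degree of the monomial `ξ^α`. -/
def monoDeg (deg : Fin N → Deg n) (α : Fin N →₀ ℕ) : Deg n := ∑ A, α A • deg A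

/-- The sign in `ξ^α ξ^β = ± ξ^{α+β}`, which arises from moving every `ξ_B` of the second factor
to the left of all `ξ_A`, `B < A`, of the first one. -/
def monoSign (deg : Fin N → Deg n) (α β : Fin N →₀ ℕ) : ℤ :=
  ∏ A, ∏ B, if B < A then sgn (deg A) (deg B) ^ (α A * β B) else 1

/-- The algebra `R[[ξ]]` of formal power series `∑_α ξ^α f_α` with `f_α ∈ R`, in variables
`ξ^A` of degree `deg A` subject to `ξ^A ξ^B = (-1)^⟨deg A, deg B⟩ ξ^B ξ^A`. -/
def Series (deg : Fin N → Deg n) (R : Type) : Type :=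
  {α : Fin N →₀ ℕ // Admissible deg α} → R

variable {deg : Fin N → Deg n} {R : Type} [CommRing R] [Algebra ℝ R]

set_option linter.unusedSectionVars false

theorem admissible_zero : Admissible deg 0 := fun _ _ => Nat.zero_le _

theorem Admissible.left {α : Fin N →₀ ℕ} (h : Admissible deg α)
    (x : {x : (Fin N →₀ ℕ) × (Fin N →₀ ℕ) // x ∈ Finset.HasAntidiagonal.antidiagonal α}) :
    Admissible deg x.1.1 := fun A hA => by
  have h1 := h A hA
  rw [← Finset.HasAntidiagonal.mem_antidiagonal.1 x.2, Finsupp.add_apply] at h1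
  omega

theorem Admissible.right {α : Fin N →₀ ℕ} (h : Admissible deg α)
    (x : {x : (Fin N →₀ ℕ) × (Fin N →₀ ℕ) // x ∈ Finset.HasAntidiagonal.antidiagonal α}) :
    Admissible deg x.1.2 := fun A hA => by
  have h1 := h A hA
  rw [← Finset.HasAntidiagonal.mem_antidiagonal.1 x.2, Finsupp.add_apply] at h1
  omega

namespace Series

instance : AddCommGroup (Series deg R) :=
  inferInstanceAs (AddCommGroup ({α : Fin N →₀ ℕ // Admissible deg α} → R))

instance : Module ℝ (Series deg R) :=
  inferInstanceAs (Module ℝ ({α : Fin N →₀ ℕ // Admissible deg α} → R))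

instance : One (Series deg R) := ⟨fun α => if α.1 = 0 then 1 else 0⟩

instance : Mul (Series deg R) :=
  ⟨fun f g α => ∑ x ∈ (Finset.HasAntidiagonal.antidiagonal α.1).attach,
    monoSign deg x.1.1 x.1.2 • (f ⟨x.1.1, α.2.left x⟩ * g ⟨x.1.2, α.2.right x⟩)⟩

/-- Extension of the coefficient family by zero. -/
def coeff (f : Series deg R) (α : Fin N →₀ ℕ) : R :=
  open Classical in if h : Admissible deg α then f ⟨α, h⟩ else 0

theorem coeff_coe (f : Series deg R) (α : {α : Fin N →₀ ℕ // Admissible deg α}) :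
    coeff f α.1 = f α := by simp [coeff, α.2]

theorem mul_apply (f g : Series deg R) (α : {α : Fin N →₀ ℕ // Admissible deg α}) :
    (f * g) α = ∑ x ∈ Finset.HasAntidiagonal.antidiagonal α.1,
      monoSign deg x.1 x.2 • (coeff f x.1 * coeff g x.2) := by
  rw [← Finset.sum_attach]
  refine Finset.sum_congr rfl fun x _ => ?_
  rw [coeff, dif_pos (α.2.left x), coeff, dif_pos (α.2.right x)]

theorem coeff_mul (f g : Series deg R) {α : Fin N →₀ ℕ} (h : Admissible deg α) :
    coeff (f * g) α = ∑ x ∈ Finset.HasAntidiagonal.antidiagonal α,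
      monoSign deg x.1 x.2 • (coeff f x.1 * coeff g x.2) :=
  (coeff_coe (f * g) ⟨α, h⟩).trans (mul_apply f g ⟨α, h⟩)

theorem coeff_one (α : Fin N →₀ ℕ) :
    coeff (1 : Series deg R) α = if α = 0 then 1 else 0 := by
  by_cases h : Admissible deg α
  · exact coeff_coe 1 ⟨α, h⟩
  · have : α ≠ 0 := fun h0 => h (h0 ▸ admissible_zero)
    simp [coeff, h, this]

theorem coeff_add (f g : Series deg R) (α : Fin N →₀ ℕ) :
    coeff (f + g) α = coeff f α + coeff g α := by
  by_cases h : Admissible deg α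
  · simp only [coeff, dif_pos h]; rfl
  · simp [coeff, h]

theorem coeff_smul (r : ℝ) (f : Series deg R) (α : Fin N →₀ ℕ) :
    coeff (r • f) α = r • coeff f α := by
  by_cases h : Admissible deg α
  · simp only [coeff, dif_pos h]; rfl
  · simp [coeff, h]

theorem coeff_zero (α : Fin N →₀ ℕ) : coeff (0 : Series deg R) α = 0 := by
  by_cases h : Admissible deg α
  · simp only [coeff, dif_pos h]; rfl
  · simp [coeff, h]

theorem ext_coeff {f g : Series deg R} (h : ∀ α, Admissible deg α → coeff f α = coeff g α) :
    f = g :=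
  funext fun α => (coeff_coe f α).symm.trans ((h α.1 α.2).trans (coeff_coe g α))

theorem monoSign_zero_left (α : Fin N →₀ ℕ) : monoSign deg 0 α = 1 := by
  simp [monoSign]

theorem monoSign_zero_right (α : Fin N →₀ ℕ) : monoSign deg α 0 = 1 := by
  simp [monoSign]

theorem monoSign_add_left (α β γ : Fin N →₀ ℕ) :
    monoSign deg (α + β) γ = monoSign deg α γ * monoSign deg β γ := by
  simp only [monoSign, ← Finset.prod_mul_distrib]
  refine Finset.prod_congr rfl fun A _ => Finset.prod_congr rfl fun B _ => ?_
  split_ifs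
  · rw [Finsupp.add_apply, add_mul, pow_add]
  · simp

theorem monoSign_add_right (α β γ : Fin N →₀ ℕ) :
    monoSign deg α (β + γ) = monoSign deg α β * monoSign deg α γ := by
  simp only [monoSign, ← Finset.prod_mul_distrib]
  refine Finset.prod_congr rfl fun A _ => Finset.prod_congr rfl fun B _ => ?_
  split_ifs
  · rw [Finsupp.add_apply, mul_add, pow_add]
  · simp

theorem admissible_of_mem {α : Fin N →₀ ℕ} (h : Admissible deg α)
    {x : (Fin N →₀ ℕ) × (Fin N →₀ ℕ)} (hx : x ∈ Finset.HasAntidiagonal.antidiagonal α) :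
    Admissible deg x.1 ∧ Admissible deg x.2 :=
  ⟨h.left ⟨x, hx⟩, h.right ⟨x, hx⟩⟩

protected theorem mul_assoc (f g k : Series deg R) : f * g * k = f * (g * k) := by
  refine ext_coeff fun α hα => ?_
  rw [coeff_mul _ _ hα, coeff_mul _ _ hα]
  have hL : ∀ x ∈ Finset.HasAntidiagonal.antidiagonal α,
      monoSign deg x.1 x.2 • (coeff (f * g) x.1 * coeff k x.2) =
      ∑ y ∈ Finset.HasAntidiagonal.antidiagonal x.1, (monoSign deg x.1 x.2 * monoSign deg y.1 y.2) •
        (coeff f y.1 * coeff g y.2 * coeff k x.2) := fun x hx => by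
    rw [coeff_mul _ _ (admissible_of_mem hα hx).1, Finset.sum_mul, Finset.smul_sum]
    refine Finset.sum_congr rfl fun y _ => ?_
    rw [smul_mul_assoc, smul_smul]
  have hR : ∀ x ∈ Finset.HasAntidiagonal.antidiagonal α,
      monoSign deg x.1 x.2 • (coeff f x.1 * coeff (g * k) x.2) =
      ∑ y ∈ Finset.HasAntidiagonal.antidiagonal x.2, (monoSign deg x.1 x.2 * monoSign deg y.1 y.2) •
        (coeff f x.1 * (coeff g y.1 * coeff k y.2)) := fun x hx => by
    rw [coeff_mul _ _ (admissible_of_mem hα hx).2, Finset.mul_sum, Finset.smul_sum]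
    refine Finset.sum_congr rfl fun y _ => ?_
    rw [mul_smul_comm, smul_smul]
  rw [Finset.sum_congr rfl hL, Finset.sum_congr rfl hR, Finset.sum_sigma', Finset.sum_sigma']
  refine Finset.sum_nbij' (fun z => ⟨(z.2.1, z.2.2 + z.1.2), (z.2.2, z.1.2)⟩)
    (fun z => ⟨(z.1.1 + z.2.1, z.2.2), (z.1.1, z.2.1)⟩) ?_ ?_ ?_ ?_ ?_
  · rintro ⟨⟨a, b⟩, ⟨c, d⟩⟩ h
    simp only [Finset.mem_sigma, Finset.HasAntidiagonal.mem_antidiagonal] at h ⊢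
    simp [← h.1, ← h.2, add_assoc]
  · rintro ⟨⟨a, b⟩, ⟨c, d⟩⟩ h
    simp only [Finset.mem_sigma, Finset.HasAntidiagonal.mem_antidiagonal] at h ⊢
    simp [← h.1, ← h.2, add_assoc]
  · rintro ⟨⟨a, b⟩, ⟨c, d⟩⟩ h
    simp only [Finset.mem_sigma, Finset.HasAntidiagonal.mem_antidiagonal] at h
    obtain ⟨-, rfl⟩ := h
    rfl
  · rintro ⟨⟨a, b⟩, ⟨c, d⟩⟩ h
    simp only [Finset.mem_sigma, Finset.HasAntidiagonal.mem_antidiagonal] at h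
    obtain ⟨-, rfl⟩ := h
    rfl
  · rintro ⟨⟨a, b⟩, ⟨c, d⟩⟩ h
    simp only [Finset.mem_sigma, Finset.HasAntidiagonal.mem_antidiagonal] at h
    obtain ⟨-, rfl⟩ := h
    simp only [monoSign_add_left, monoSign_add_right, mul_assoc]
    congr 1
    ring

protected theorem one_mul (f : Series deg R) : 1 * f = f := by
  refine ext_coeff fun α hα => ?_
  rw [coeff_mul _ _ hα, Finset.sum_eq_single (0, α)]
  · simp [coeff_one, monoSign_zero_left]
  · rintro ⟨a, b⟩ h hne
    have : a ≠ 0 := by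
      rintro rfl
      exact hne (by simpa using h)
    simp [coeff_one, this]
  · simp

protected theorem mul_one (f : Series deg R) : f * 1 = f := by
  refine ext_coeff fun α hα => ?_
  rw [coeff_mul _ _ hα, Finset.sum_eq_single (α, 0)]
  · simp [coeff_one, monoSign_zero_right]
  · rintro ⟨a, b⟩ h hne
    have : b ≠ 0 := by
      rintro rfl
      exact hne (by simpa using h)
    simp [coeff_one, this]
  · simp

protected theorem mul_add (f g k : Series deg R) : f * (g + k) = f * g + f * k := by
  refine ext_coeff fun α hα => ?_
  simp only [coeff_add, coeff_mul _ _ hα, mul_add, smul_add, Finset.sum_add_distrib]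

protected theorem add_mul (f g k : Series deg R) : (f + g) * k = f * k + g * k := by
  refine ext_coeff fun α hα => ?_
  simp only [coeff_add, coeff_mul _ _ hα, add_mul, smul_add, Finset.sum_add_distrib]

instance : Ring (Series deg R) :=
  { (inferInstance : AddCommGroup (Series deg R)) with
    mul := (· * ·)
    one := 1
    mul_assoc := Series.mul_assoc
    one_mul := Series.one_mul
    mul_one := Series.mul_one
    left_distrib := Series.mul_add
    right_distrib := Series.add_mul
    zero_mul := fun f => ext_coeff fun α hα => by simp [coeff_mul _ _ hα, coeff_zero]
    mul_zero := fun f => ext_coeff fun α hα => by simp [coeff_mul _ _ hα, coeff_zero] }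

instance : Algebra ℝ (Series deg R) :=
  Algebra.ofModule
    (fun r f g => ext_coeff fun α hα => by
      simp only [coeff_smul, coeff_mul _ _ hα, smul_mul_assoc, Finset.smul_sum]
      exact Finset.sum_congr rfl fun x _ => smul_comm _ _ _)
    (fun r f g => ext_coeff fun α hα => by
      simp only [coeff_smul, coeff_mul _ _ hα, mul_smul_comm, Finset.smul_sum]
      exact Finset.sum_congr rfl fun x _ => smul_comm _ _ _)

/-- `f = ∑_α ξ^α f_α` is homogeneous of degree `a`. -/
def IsHomogeneous (f : Series deg R) (a : Deg n) : Prop :=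
  ∀ α : {α : Fin N →₀ ℕ // Admissible deg α}, monoDeg deg α.1 ≠ a → f α = 0

/-- An element of `R`, regarded as a power series. -/
def const (r : R) : Series deg R := fun α => if α.1 = 0 then r else 0

/-- The variable `ξ^A`. -/
def var (A : Fin N) : Series deg R := fun α => if α.1 = Finsupp.single A 1 then 1 else 0

/-- The (left) derivative `∂/∂ξ^A`. As `∂/∂ξ^A` has degree `deg A`, moving it past the variables
`ξ^B`, `B < A`, of `ξ^β`, `β = α + e_A`, gives the sign `monoSign deg e_A β = monoSign deg e_A α`,
so that `∂/∂ξ^A (ξ^β) = ± β_A ξ^α`. -/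
def varDeriv (A : Fin N) (f : Series deg R) : Series deg R := fun α =>
  (((α.1 A + 1 : ℕ) : ℤ) * monoSign deg (Finsupp.single A 1) α.1) •
    coeff f (α.1 + Finsupp.single A 1)

end Series

end Series

/-! ## The local model `(V, C^∞(-)[[ξ]])` -/

section Model

variable {n p N : ℕ}

/-- The algebra `C^∞(V)[[ξ]]` of functions on the `ℤ₂ⁿ`-domain over `V ⊆ ℝ^p`. -/
abbrev Model (deg : Fin N → Deg n) (V : Opens (Fin p → ℝ)) : Type := Series deg (Smooth V)

/-- The degree of the coordinate `x^I`: the base coordinates `x^a` (`I = Sum.inl a`) have degree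
zero, the formal coordinates `ξ^A` (`I = Sum.inr A`) have degree `deg A`. -/
def coordDeg (deg : Fin N → Deg n) : Fin p ⊕ Fin N → Deg n := Sum.elim (fun _ => 0) deg

variable {deg : Fin N → Deg n}

/-- The restriction `C^∞(V)[[ξ]] → C^∞(V')[[ξ]]`. -/
def Model.restrict {V V' : Opens (Fin p → ℝ)} (h : V' ≤ V) (f : Model deg V) : Model deg V' :=
  fun α => Smooth.restrict h (f α)

/-- The coordinates `x^I = (x^a, ξ^A)`. -/
def Model.coord (V : Opens (Fin p → ℝ)) : Fin p ⊕ Fin N → Model deg V :=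
  Sum.elim (fun a => Series.const (Smooth.coord V a)) (fun A => Series.var A)

/-- The partial derivatives `∂/∂x^I`. -/
def Model.partialDeriv {V : Opens (Fin p → ℝ)} :
    Fin p ⊕ Fin N → Model deg V → Model deg V :=
  Sum.elim (fun a f α => Smooth.partialDeriv a (f α)) (fun A f => Series.varDeriv A f)

end Model

/-! ## `ℤ₂ⁿ`-manifolds -/

/-- A locally `ℤ₂ⁿ`-ringed space: a second-countable Hausdorff space with a sheaf of
`ℤ₂ⁿ`-graded `ℤ₂ⁿ`-commutative associative unital `ℝ`-algebras whose stalks are local rings. -/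
structure LocallyRingedSpace (n : ℕ) where
  carrier : TopCat.{u}
  t2 : T2Space carrier
  secondCountable : SecondCountableTopology carrier
  presheaf : TopCat.Presheaf (AlgCat.{u} ℝ) carrier
  isSheaf : presheaf.IsSheaf
  /-- `grading U a` consists of the sections over `U` of degree `a`. -/
  grading : (U : Opens carrier) → Deg n → Submodule ℝ (presheaf.obj (op U))
  gradedAlgebra : (U : Opens carrier) → GradedAlgebra (grading U)
  map_mem : ∀ {U V : Opens carrier} (i : V ⟶ U) (a : Deg n) (s : presheaf.obj (op U)),
    s ∈ grading U a → (presheaf.map i.op).hom s ∈ grading V a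
  mul_comm_sgn : ∀ (U : Opens carrier) (a b : Deg n) (s t : presheaf.obj (op U)),
    s ∈ grading U a → t ∈ grading U b → s * t = sgn a b • (t * s)
  isLocalRing_stalk : ∀ x : carrier,
    IsLocalRing (TopCat.Presheaf.stalk (C := RingCat.{u})
      (presheaf ⋙ forget₂ (AlgCat.{u} ℝ) RingCat.{u}) x)

namespace LocallyRingedSpace

variable {n : ℕ} (S : LocallyRingedSpace.{u} n)

/-- The algebra of sections `𝒪(U)`. -/
abbrev Sec (U : Opens S.carrier) : Type u := S.presheaf.obj (op U)

instance (U : Opens S.carrier) : GradedAlgebra (S.grading U) := S.gradedAlgebra U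

variable {S} in
/-- The restriction `𝒪(U) → 𝒪(V)` for `V ⊆ U`. -/
def res {U V : Opens S.carrier} (h : V ≤ U) : S.Sec U →ₐ[ℝ] S.Sec V :=
  (S.presheaf.map (homOfLE h).op).hom

variable {S} in
/-- The linear map with `twist b f = (-1)^⟨b, a⟩ f` for `f` homogeneous of degree `a`; an
element `f` is moved past a symbol `y` of degree `b` by `f y = y (twist b f)`. -/
def twist {U : Opens S.carrier} (b : Deg n) (f : S.Sec U) : S.Sec U :=
  ∑ a : Deg n, sgn b a • GradedRing.proj (S.grading U) a f

/-- The image of an open set `W` under an open partial homeomorphism onto an open part of `ℝ^p`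
(only the part of `W` inside the source counts). -/
def imageOpens {X : TopCat.{u}} {p : ℕ} (φ : OpenPartialHomeomorph X (Fin p → ℝ))
    (W : Opens X) : Opens (Fin p → ℝ) :=
  ⟨φ.target ∩ φ.symm ⁻¹' W, φ.isOpen_inter_preimage_symm W.2⟩

theorem imageOpens_mono {X : TopCat.{u}} {p : ℕ} (φ : OpenPartialHomeomorph X (Fin p → ℝ))
    {W W' : Opens X} (h : W' ≤ W) : imageOpens φ W' ≤ imageOpens φ W :=
  fun _ hx => ⟨hx.1, h hx.2⟩

/-- A chart: an isomorphism of an open subspace of `S` with a `ℤ₂ⁿ`-domain over an open subset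
of `ℝ^p`, with formal coordinates of degrees `deg`. It consists of a homeomorphism `homeo` of an
open set `dom` of `S` onto an open subset of `ℝ^p`, and of degree-preserving algebra isomorphisms
`𝒪(W) ≃ C^∞(homeo(W))[[ξ]]`, for `W ⊆ dom` open, that commute with restrictions. -/
structure Chart {p N : ℕ} (deg : Fin N → Deg n) where
  homeo : OpenPartialHomeomorph S.carrier (Fin p → ℝ)
  dom : Opens S.carrier
  source_eq : homeo.source = dom
  iso : (W : Opens S.carrier) → W ≤ dom → (S.Sec W ≃ₐ[ℝ] Model deg (imageOpens homeo W))
  iso_isHomogeneous : ∀ (W : Opens S.carrier) (hW : W ≤ dom) (a : Deg n) (s : S.Sec W),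
    s ∈ S.grading W a → (iso W hW s).IsHomogeneous a
  iso_res : ∀ {W W' : Opens S.carrier} (hW : W ≤ dom) (h : W' ≤ W) (s : S.Sec W),
    iso W' (h.trans hW) (res h s) = Model.restrict (imageOpens_mono homeo h) (iso W hW s)

namespace Chart

variable {S} {p N : ℕ} {deg : Fin N → Deg n}

/-- The coordinates `x^I ∈ 𝒪(W)`. -/
def coord (c : S.Chart (p := p) deg) {W : Opens S.carrier} (hW : W ≤ c.dom) (I : Fin p ⊕ Fin N) :
    S.Sec W :=
  (c.iso W hW).symm (Model.coord _ I)

/-- The partial derivatives `∂/∂x^I : 𝒪(W) → 𝒪(W)`. -/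
def partialDeriv (c : S.Chart (p := p) deg) {W : Opens S.carrier} (hW : W ≤ c.dom)
    (I : Fin p ⊕ Fin N) (f : S.Sec W) : S.Sec W :=
  (c.iso W hW).symm (Model.partialDeriv I (c.iso W hW f))

end Chart

end LocallyRingedSpace

/-- A `ℤ₂ⁿ`-manifold of dimension `p|𝐪`, where `q_i` is the number of `A` with
`deg A = γ_i ≠ 0`. -/
structure Manifold (n : ℕ) extends LocallyRingedSpace.{u} n where
  p : ℕ
  N : ℕ
  deg : Fin N → Deg n
  deg_ne_zero : ∀ A, deg A ≠ 0
  exists_chart : ∀ x : carrier,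
    ∃ c : toLocallyRingedSpace.Chart (p := p) deg, x ∈ c.dom

namespace Manifold

open LocallyRingedSpace

variable {n : ℕ} (M : Manifold.{u} n)

/-- The charts of `M`. -/
abbrev Chart : Type u := M.toLocallyRingedSpace.Chart (p := M.p) M.deg

/-- The indices of the coordinates `x^I = (x^a, ξ^A)`. -/
abbrev Idx : Type := Fin M.p ⊕ Fin M.N

/-- The degree `deg(I)` of the coordinate `x^I`. -/
abbrev idxDeg (I : M.Idx) : Deg n := coordDeg M.deg I

/-- The degree of `dx^{I_1} ⋯ dx^{I_k}` in `ℤ₂ⁿ`. -/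
def wordDeg {k : ℕ} (w : Fin k → M.Idx) : Deg n := ∑ t, M.idxDeg (w t)

/-- The algebra `C^∞(M) = 𝒪(|M|)` of functions on `M`. -/
abbrev Fn : Type u := M.Sec ⊤

/-! ### Vector fields -/

/-- The derivations of the structure sheaf of degree `δ`: families of linear endomorphisms of the
`𝒪(U)` that commute with restrictions, are of degree `δ` and satisfy the graded Leibniz rule. -/
def derivations (δ : Deg n) : Submodule ℝ ((U : Opens M.carrier) → (M.Sec U →ₗ[ℝ] M.Sec U)) where
  carrier := {D |
    (∀ (U V : Opens M.carrier) (h : V ≤ U) (f : M.Sec U), res h (D U f) = D V (res h f)) ∧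
    (∀ (U : Opens M.carrier) (a : Deg n) (f : M.Sec U),
      f ∈ M.grading U a → D U f ∈ M.grading U (δ + a)) ∧
    (∀ (U : Opens M.carrier) (a : Deg n) (f g : M.Sec U), f ∈ M.grading U a →
      D U (f * g) = D U f * g + sgn δ a • (f * D U g))}
  add_mem' := by
    rintro D E ⟨h1, h2, h3⟩ ⟨k1, k2, k3⟩
    refine ⟨fun U V h f => ?_, fun U a f hf => add_mem (h2 U a f hf) (k2 U a f hf),
      fun U a f g hf => ?_⟩
    · simp [h1 U V h, k1 U V h]
    · simp only [Pi.add_apply, LinearMap.add_apply, h3 U a f g hf, k3 U a f g hf, add_mul,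
        mul_add, smul_add]
      abel
  zero_mem' := ⟨by simp, fun U a f _ => zero_mem _, by simp⟩
  smul_mem' := by
    rintro r D ⟨h1, h2, h3⟩
    refine ⟨fun U V h f => ?_, fun U a f hf => Submodule.smul_mem _ r (h2 U a f hf),
      fun U a f g hf => ?_⟩
    · simp [h1 U V h]
    · simp only [Pi.smul_apply, LinearMap.smul_apply, h3 U a f g hf, smul_add, smul_mul_assoc,
        mul_smul_comm]
      rw [smul_comm r]

/-- The vector fields on `M`, i.e. the global sections of the tangent sheaf: the sums of
homogeneous derivations of the structure sheaf. For `X : M.Vect`, `X.1 U : 𝒪(U) → 𝒪(U)` is the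
restriction of `X` to `U`. -/
def Vect : Submodule ℝ ((U : Opens M.carrier) → (M.Sec U →ₗ[ℝ] M.Sec U)) :=
  ⨆ δ, M.derivations δ

/-! ### Differential forms

In a chart with coordinates `x^I`, a `k`-form is a function on the `ℤ₂ⁿ⁺¹`-graded tangent bundle
with coordinates `x^I` of degree `(0, deg I)` and `dx^I` of degree `(1, deg I)`, that is of order
`k` in the `dx^I`. It is written uniquely as
`α = 1/k! ∑ dx^{I_1} ⋯ dx^{I_k} α_{I_k ⋯ I_1}` with coefficients that have the same symmetry as the
products `dx^{I_1} ⋯ dx^{I_k}`, where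
`dx^I dx^J = -(-1)^⟨deg I, deg J⟩ dx^J dx^I` and `f dx^I = (-1)^⟨deg f, deg I⟩ dx^I f`. -/

/-- Families of local expressions of `k`-forms, one for each chart:
`α c ![I_1, …, I_k] = α_{I_k ⋯ I_1}`. -/
abbrev LocalForms (k : ℕ) : Type u := (c : M.Chart) → (Fin k → M.Idx) → M.Sec c.dom

/-- The coefficients in
`(dx^{I_1} ∂x^{I'_1}/∂x^{I_1}) ⋯ (dx^{I_k} ∂x^{I'_k}/∂x^{I_k})
  = dx^{I_1} ⋯ dx^{I_k} jacobian ![I_1, …, I_k] ![I'_1, …, I'_k]`,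
for charts `c`, `c'` with coordinates `x^I`, `x^{I'}`; the coefficient of the first factor is
moved past the product `dx^{I_2} ⋯ dx^{I_k}`. -/
def jacobian (c c' : M.Chart) : (k : ℕ) → (w w' : Fin k → M.Idx) → M.Sec (c.dom ⊓ c'.dom)
  | 0, _, _ => 1
  | k + 1, w, w' =>
    twist (M.wordDeg (Fin.tail w))
      (c.partialDeriv inf_le_left (w 0) (c'.coord inf_le_right (w' 0))) *
    jacobian c c' k (Fin.tail w) (Fin.tail w')

variable {M}

/-- The local expressions define a global differential `k`-form on `M`: the coefficients have the
symmetry of the products of the `dx^I`, and the expressions for any two charts agree on the overlap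
under `dx^{I'} = dx^I ∂x^{I'}/∂x^I`. -/
structure IsForm {k : ℕ} (α : M.LocalForms k) : Prop where
  skew : ∀ (c : M.Chart) (w : Fin k → M.Idx) (i j : Fin k), (j : ℕ) = i + 1 →
    α c (w ∘ Equiv.swap i j) = -(sgn (M.idxDeg (w i)) (M.idxDeg (w j)) • α c w)
  transform : ∀ (c c' : M.Chart) (w : Fin k → M.Idx),
    res inf_le_left (α c w) =
      ∑ w' : Fin k → M.Idx, M.jacobian c c' k w w' * res inf_le_right (α c' w')

/-- `α` is homogeneous of `ℤ₂ⁿ`-degree `γ`. -/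
def IsOfDegree {k : ℕ} (α : M.LocalForms k) (γ : Deg n) : Prop :=
  ∀ (c : M.Chart) (w : Fin k → M.Idx), α c w ∈ M.grading c.dom (γ + M.wordDeg w)

/-- A function as a `0`-form. -/
def zeroForm (f : M.Fn) : M.LocalForms 0 := fun _ _ => res le_top f

/-- The de Rham derivative `d = dx^K ∂/∂x^K`. Here
`∂/∂x^K (dx^{J_1} ⋯ dx^{J_k} g) = (-1)^⟨deg K, deg J_1 + ⋯ + deg J_k⟩ dx^{J_1} ⋯ dx^{J_k} ∂g/∂x^K`,
and the coefficient of `dx^{I_1} ⋯ dx^{I_{k+1}}` collects, for every `s`, the term with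
`K = I_s`, whose sign comes from moving `dx^{I_s}` to the left of `dx^{I_1} ⋯ dx^{I_{s-1}}`. -/
def deRham {k : ℕ} (α : M.LocalForms k) : M.LocalForms (k + 1) := fun c w =>
  ∑ s : Fin (k + 1),
    ((-1) ^ (s : ℕ) * (∏ t ∈ Finset.Iio s, sgn (M.idxDeg (w s)) (M.idxDeg (w t))) *
        sgn (M.idxDeg (w s)) (M.wordDeg (w ∘ s.succAbove))) •
      c.partialDeriv le_rfl (w s) (α c (w ∘ s.succAbove))

/-- The interior product `i_X = X^I ∂/∂(dx^I)`, where `X^I = X(x^I)`. The derivative `∂/∂(dx^I)` of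
`1/(k+1)! ∑ dx^{I_1} ⋯ dx^{I_{k+1}} α_{I_{k+1} ⋯ I_1}` is
`1/k! ∑ dx^{I_2} ⋯ dx^{I_{k+1}} α_{I_{k+1} ⋯ I_2 I}`, and `X^I` is then moved to the right of the
product of the `dx`. -/
def contract {k : ℕ} (X : M.Vect) (α : M.LocalForms (k + 1)) : M.LocalForms k := fun c w =>
  ∑ I : M.Idx, twist (M.wordDeg w) (X.1 c.dom (c.coord le_rfl I)) * α c (Fin.cons I w)

/-! ### Symplectic structures and Poisson brackets -/

/-- The two-form `ω = 1/2 dx^I dx^J ω_{JI}` is nondegenerate: the matrix `(ω_{JI})` is invertible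
in every chart. -/
def IsNondegenerate (ω : M.LocalForms 2) : Prop :=
  ∀ c : M.Chart, IsUnit (Matrix.of fun J I : M.Idx => ω c ![I, J])

/-- `ω` is a symplectic structure of `ℤ₂ⁿ`-degree `γ` on `M`: a nondegenerate closed two-form of
degree `γ`. -/
structure IsSymplectic (ω : M.LocalForms 2) (γ : Deg n) : Prop where
  isForm : IsForm ω
  isOfDegree : IsOfDegree ω γ
  isNondegenerate : IsNondegenerate ω
  closed : deRham ω = 0

open Classical in
/-- The Hamiltonian vector field `X_f`, i.e. the solution of `i_{X_f} ω = df` (with value `0` if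
there is none). -/
def hamiltonian (ω : M.LocalForms 2) (f : M.Fn) : M.Vect :=
  if h : ∃ X : M.Vect, contract X ω = deRham (zeroForm f) then h.choose else 0

/-- The Poisson bracket `{f, g}_ω = X_f(g)`. -/
def poisson (ω : M.LocalForms 2) (f g : M.Fn) : M.Fn := (hamiltonian ω f).1 ⊤ g

end Manifold

end Z2nGeometry

end

open Z2nGeometry Z2nGeometry.Manifold

/-!
In a chart with coordinates `x^I` the equation `i_X ω = df` is a linear system for the components
`X^I = X(x^I)`: moving `X^I` past the coefficients of `ω` turns it into
`(ω_{JI}) (± X^I) = (∂f/∂x^J)`, with signs that do not depend on `J`. As the matrix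
`(ω_{JI})` is invertible, the components of `X` are determined by `f`
(`IsSymplectic.eq_of_sum_twist_mul_eq`), and for `f` homogeneous of degree `a` they can be found of
the degrees of the components of a vector field of degree `a + γ`
(`IsSymplectic.exists_homogeneous_solution`).

That components and vector fields are the same thing rests on
`localDerivations_eq_zero_of_coord`: a derivation of the structure sheaf that kills the coordinates
vanishes. This is a consequence of Hadamard's lemma (`Model.exists_restrict_eq`), applied repeatedly,
once for every order in the formal variables. It gives the uniqueness of `X_f`, the chain rule for
changes of charts, and the graded commutativity of the partial derivatives. By the chain rule and
the transformation law of `ω`, the solutions over different charts agree on overlaps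
(`IsForm.solution_transform`), so that they glue to a global vector field.

The Jacobi identity says that `X_{{f, g}}` is the graded commutator of `X_f` and `X_g`. By
uniqueness it suffices that the commutator solves `i_{[X_f, X_g]} ω = d (X_f g)`, which is
`sum_twist_commutator_mul`, a computation in a chart: the derivatives of the components of `ω` that
occur in it cancel because `dω = 0`, the remaining terms because `ω` is skew symmetric.
-/

noncomputable section

open CategoryTheory TopologicalSpace Opposite

namespace Z2nGeometry

/-! ### Signs -/

section Signs

variable {n : ℕ}

/-- The character `z ↦ (-1)^z` of `ℤ₂`. Rewriting products of signs as values of this character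
reduces every sign identity to a linear identity in `ℤ₂`. -/
def parity (z : ZMod 2) : ℤ := if z = 0 then 1 else -1

theorem parity_mul (y z : ZMod 2) : parity y * parity z = parity (y + z) := by
  revert y z; decide

theorem parity_mul_self (z : ZMod 2) : parity z * parity z = 1 := by
  revert z; decide

theorem sgn_eq_parity (a b : Deg n) : sgn a b = parity (a ⬝ᵥ b) := rfl

theorem sgn_add_left (a b c : Deg n) : sgn (a + b) c = sgn a c * sgn b c := by
  simp only [sgn_eq_parity, parity_mul, add_dotProduct]

theorem sgn_add_right (a b c : Deg n) : sgn a (b + c) = sgn a b * sgn a c := by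
  simp only [sgn_eq_parity, parity_mul, dotProduct_add]

theorem sgn_comm (a b : Deg n) : sgn a b = sgn b a := by
  simp only [sgn_eq_parity, dotProduct_comm]

theorem sgn_mul_self (a b : Deg n) : sgn a b * sgn a b = 1 := parity_mul_self _

theorem sgn_zero_left (a : Deg n) : sgn 0 a = 1 := by simp [sgn]

theorem sgn_zero_right (a : Deg n) : sgn a 0 = 1 := by simp [sgn]

theorem sgn_nsmul_right (a b : Deg n) (k : ℕ) : sgn a (k • b) = sgn a b ^ k := by
  induction k with
  | zero => simp [sgn_zero_right]
  | succ k ih => rw [succ_nsmul, sgn_add_right, ih, pow_succ]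

theorem sgn_sum_right {ι : Type*} (s : Finset ι) (a : Deg n) (b : ι → Deg n) :
    sgn a (∑ i ∈ s, b i) = ∏ i ∈ s, sgn a (b i) := by
  classical
  induction s using Finset.induction_on with
  | empty => simp [sgn_zero_right]
  | insert i s hi ih => rw [Finset.sum_insert hi, Finset.prod_insert hi, sgn_add_right, ih]

theorem deg_add_self (a : Deg n) : a + a = 0 := by
  ext i
  exact CharTwo.add_self_eq_zero (a i)

theorem deg_add_add_self (a b : Deg n) : a + b + b = a := by
  rw [add_assoc, deg_add_self, add_zero]

end Signs

/-! ### Derivatives of formal power series -/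

namespace Series

variable {n N : ℕ} {deg : Fin N → Deg n} {R : Type} [CommRing R]

theorem coeff_eq_zero_of_not {f : Series deg R} {α : Fin N →₀ ℕ} (h : ¬ Admissible deg α) :
    coeff f α = 0 := by simp [coeff, h]

theorem monoDeg_add (α β : Fin N →₀ ℕ) : monoDeg deg (α + β) = monoDeg deg α + monoDeg deg β := by
  simp only [monoDeg, Finsupp.add_apply, add_smul, Finset.sum_add_distrib]

theorem monoDeg_single (A : Fin N) : monoDeg deg (Finsupp.single A 1) = deg A := by
  rw [monoDeg, Finset.sum_eq_single A]
  · simp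
  · intro B _ hB
    simp [Finsupp.single_eq_of_ne hB]
  · simp

theorem monoDeg_zero : monoDeg deg (0 : Fin N →₀ ℕ) = 0 := by simp [monoDeg]

theorem const_isHomogeneous (r : R) : (const r : Series deg R).IsHomogeneous 0 := by
  rintro ⟨α, hα⟩ h
  refine if_neg ?_
  rintro rfl
  exact h monoDeg_zero

theorem var_isHomogeneous (A : Fin N) : (var A : Series deg R).IsHomogeneous (deg A) := by
  rintro ⟨α, hα⟩ h
  refine if_neg ?_
  rintro rfl
  exact h (monoDeg_single A)

variable [Algebra ℝ R]

theorem monoSign_mul_self (α β : Fin N →₀ ℕ) : monoSign deg α β * monoSign deg α β = 1 := by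
  simp only [monoSign, ← Finset.prod_mul_distrib]
  refine Finset.prod_eq_one fun A _ => Finset.prod_eq_one fun B _ => ?_
  split_ifs
  · rw [← mul_pow, sgn_mul_self, one_pow]
  · rfl

/-- Moving the variable `ξ^A` past `ξ^α` costs the sign of their degrees, except for the `ξ^A`
contained in `ξ^α`. -/
theorem monoSign_single_mul (A : Fin N) (α : Fin N →₀ ℕ) :
    monoSign deg α (Finsupp.single A 1) * monoSign deg (Finsupp.single A 1) α =
      sgn (deg A) (monoDeg deg α) * sgn (deg A) (deg A) ^ α A := by
  have h1 : monoSign deg α (Finsupp.single A 1) =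
      ∏ B, if A < B then sgn (deg A) (deg B) ^ α B else 1 := by
    refine Finset.prod_congr rfl fun B _ => ?_
    rw [Finset.prod_eq_single A]
    · simp [sgn_comm]
    · intro C _ hC
      simp [Finsupp.single_eq_of_ne hC]
    · simp
  have h2 : monoSign deg (Finsupp.single A 1) α =
      ∏ B, if B < A then sgn (deg A) (deg B) ^ α B else 1 := by
    rw [monoSign, Finset.prod_eq_single A]
    · simp
    · intro C _ hC
      simp [Finsupp.single_eq_of_ne hC]
    · simp
  have h3 : sgn (deg A) (deg A) ^ α A =
      ∏ B, if B = A then sgn (deg A) (deg B) ^ α B else 1 := by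
    rw [Finset.prod_ite_eq' Finset.univ A]; simp
  rw [h1, h2, h3, monoDeg, sgn_sum_right, ← Finset.prod_mul_distrib, ← Finset.prod_mul_distrib]
  refine Finset.prod_congr rfl fun B _ => ?_
  rw [sgn_nsmul_right]
  rcases lt_trichotomy A B with h | h | h
  · simp [h, h.not_gt, h.ne']
  · subst h
    simp [← mul_pow, sgn_mul_self]
  · simp [h, h.not_gt, h.ne]

theorem IsHomogeneous.coeff_eq_zero {f : Series deg R} {a : Deg n} (hf : f.IsHomogeneous a)
    {α : Fin N →₀ ℕ} (h : monoDeg deg α ≠ a) : coeff f α = 0 := by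
  by_cases hα : Admissible deg α
  · exact (coeff_coe f ⟨α, hα⟩).trans (hf ⟨α, hα⟩ h)
  · exact coeff_eq_zero_of_not hα

theorem coeff_varDeriv (A : Fin N) (f : Series deg R) {α : Fin N →₀ ℕ} (h : Admissible deg α) :
    coeff (varDeriv A f) α =
      (((α A + 1 : ℕ) : ℤ) * monoSign deg (Finsupp.single A 1) α) •
        coeff f (α + Finsupp.single A 1) :=
  coeff_coe (varDeriv A f) ⟨α, h⟩

theorem varDeriv_add (A : Fin N) (f g : Series deg R) :
    varDeriv A (f + g) = varDeriv A f + varDeriv A g :=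
  ext_coeff fun α hα => by
    simp only [coeff_add, coeff_varDeriv _ _ hα, smul_add]

theorem varDeriv_smul (A : Fin N) (r : ℝ) (f : Series deg R) :
    varDeriv A (r • f) = r • varDeriv A f :=
  ext_coeff fun α hα => by
    simp only [coeff_smul, coeff_varDeriv _ _ hα]
    exact smul_comm _ _ _

theorem varDeriv_isHomogeneous (A : Fin N) {f : Series deg R} {a : Deg n}
    (hf : f.IsHomogeneous a) : (varDeriv A f).IsHomogeneous (deg A + a) := by
  rintro ⟨α, hα⟩ h
  refine (coeff_coe (varDeriv A f) ⟨α, hα⟩).symm.trans ?_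
  rw [coeff_varDeriv A f hα, hf.coeff_eq_zero, smul_zero]
  rw [monoDeg_add, monoDeg_single]
  rintro rfl
  exact h (by rw [add_comm (monoDeg deg α), ← add_assoc, deg_add_self, zero_add])

/-- Sums over the splittings of `α` become sums over the splittings of `α + e_A` when the summand
carries a factor that vanishes on the splittings with `x_A = 0`. -/
theorem sum_antidiagonal_add_single_left {G : Type*} [AddCommMonoid G] (A : Fin N)
    (α : Fin N →₀ ℕ) (F : (Fin N →₀ ℕ) → (Fin N →₀ ℕ) → G) (hF : ∀ x y, x A = 0 → F x y = 0) :
    ∑ x ∈ Finset.HasAntidiagonal.antidiagonal (α + Finsupp.single A 1), F x.1 x.2 =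
      ∑ x ∈ Finset.HasAntidiagonal.antidiagonal α, F (x.1 + Finsupp.single A 1) x.2 := by
  symm
  refine Finset.sum_of_injOn (fun x => (x.1 + Finsupp.single A 1, x.2)) ?_ ?_ ?_ ?_
  · rintro ⟨x, y⟩ _ ⟨x', y'⟩ _ h
    simpa using h
  · rintro ⟨x, y⟩ h
    simp only [Finset.mem_coe, Finset.HasAntidiagonal.mem_antidiagonal] at h ⊢
    rw [← h]; abel
  · rintro ⟨x, y⟩ h hn
    refine hF x y ?_
    by_contra hx
    refine hn ⟨(x - Finsupp.single A 1, y), ?_, ?_⟩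
    · simp only [Finset.mem_coe, Finset.HasAntidiagonal.mem_antidiagonal] at h ⊢
      have hle : Finsupp.single A 1 ≤ x :=
        Finsupp.single_le_iff.2 (Nat.one_le_iff_ne_zero.2 hx)
      refine add_right_cancel (b := Finsupp.single A 1) ?_
      rw [← h, add_right_comm, tsub_add_cancel_of_le hle]
    · have hle : Finsupp.single A 1 ≤ x :=
        Finsupp.single_le_iff.2 (Nat.one_le_iff_ne_zero.2 hx)
      simp [tsub_add_cancel_of_le hle]
  · simp

theorem sum_antidiagonal_add_single_right {G : Type*} [AddCommMonoid G] (A : Fin N)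
    (α : Fin N →₀ ℕ) (F : (Fin N →₀ ℕ) → (Fin N →₀ ℕ) → G) (hF : ∀ x y, y A = 0 → F x y = 0) :
    ∑ x ∈ Finset.HasAntidiagonal.antidiagonal (α + Finsupp.single A 1), F x.1 x.2 =
      ∑ x ∈ Finset.HasAntidiagonal.antidiagonal α, F x.1 (x.2 + Finsupp.single A 1) := by
  have h := sum_antidiagonal_add_single_left A α (fun x y => F y x) (fun x y => hF y x)
  have swap : ∀ (β : Fin N →₀ ℕ) (H : (Fin N →₀ ℕ) → (Fin N →₀ ℕ) → G),
      ∑ x ∈ Finset.HasAntidiagonal.antidiagonal β, H x.1 x.2 =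
        ∑ x ∈ Finset.HasAntidiagonal.antidiagonal β, H x.2 x.1 := fun β H =>
    Finset.sum_equiv (Equiv.prodComm _ _) (by rintro ⟨x, y⟩; simp [add_comm]) (by simp)
  rw [swap, h, swap α (fun x y => F x (y + Finsupp.single A 1))]

open Classical in
/-- The number of `ξ^A` in `ξ^x ξ^y`, counted by applying the Leibniz rule. For odd `ξ^A` the
formula also expresses that `∂/∂ξ^A` is compatible with `ξ^A ξ^A = 0`. -/
theorem varDeriv_count (A : Fin N) {x y α : Fin N →₀ ℕ} (hα : Admissible deg α)
    (h : x + y = α + Finsupp.single A 1) (hx : Admissible deg x) (hy : Admissible deg y) :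
    (x A : ℤ) + sgn (deg A) (deg A) ^ x A * y A =
      if Admissible deg (α + Finsupp.single A 1) then (α A : ℤ) + 1 else 0 := by
  have hA : x A + y A = α A + 1 := by
    have := DFunLike.congr_fun h A
    simpa using this
  have h0 : ∀ B, B ≠ A → (α + Finsupp.single A 1 : Fin N →₀ ℕ) B = α B := fun B hB => by
    simp [Finsupp.single_eq_of_ne hB]
  by_cases hodd : deg A ⬝ᵥ deg A = 0
  · have hadm : Admissible deg (α + Finsupp.single A 1) := fun B hB => by
      rw [h0 B (by rintro rfl; exact hB hodd)]
      exact hα B hB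
    rw [if_pos hadm, sgn, if_pos hodd, one_pow, one_mul]
    exact_mod_cast hA
  · have h1 := hx A hodd
    have h2 := hy A hodd
    have h3 := hα A hodd
    rw [sgn, if_neg hodd]
    by_cases hadm : Admissible deg (α + Finsupp.single A 1)
    · have h4 := hadm A hodd
      simp only [Finsupp.add_apply, Finsupp.single_eq_same] at h4
      rw [if_pos hadm]
      have h5 : α A = 0 := by omega
      have h6 : (x A = 0 ∧ y A = 1) ∨ (x A = 1 ∧ y A = 0) := by omega
      rcases h6 with ⟨h6, h7⟩ | ⟨h6, h7⟩ <;> simp [h5, h6, h7]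
    · rw [if_neg hadm]
      have h5 : α A = 1 := by
        by_contra h5
        refine hadm fun B hB => ?_
        by_cases hBA : B = A
        · subst hBA
          simp; omega
        · rw [h0 B hBA]
          exact hα B hB
      have h6 : x A = 1 ∧ y A = 1 := by omega
      simp [h6.1, h6.2]

/-- The graded Leibniz rule for `∂/∂ξ^A`. -/
theorem varDeriv_mul (A : Fin N) {f : Series deg R} {a : Deg n} (hf : f.IsHomogeneous a)
    (g : Series deg R) :
    varDeriv A (f * g) = varDeriv A f * g + sgn (deg A) a • (f * varDeriv A g) := by
  classical
  set e : Fin N →₀ ℕ := Finsupp.single A 1 with he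
  refine ext_coeff fun α hα => ?_
  have hz : ∀ (k : ℤ) (f : Series deg R) (α : Fin N →₀ ℕ), coeff (k • f) α = k • coeff f α := by
    intro k f α
    rw [← Int.cast_smul_eq_zsmul ℝ, coeff_smul, Int.cast_smul_eq_zsmul]
  rw [coeff_add, hz, coeff_varDeriv _ _ hα, coeff_mul _ _ hα, coeff_mul _ _ hα]
  -- all three sums are written over the splittings of `α + e_A`
  have hL : coeff (f * g) (α + e) = ∑ x ∈ Finset.HasAntidiagonal.antidiagonal (α + e),
      (if Admissible deg (α + e) then monoSign deg x.1 x.2 else 0) •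
        (coeff f x.1 * coeff g x.2) := by
    by_cases h : Admissible deg (α + e)
    · simp only [coeff_mul _ _ h, if_pos h]
    · simp [coeff_eq_zero_of_not h, h]
  have h1 : ∑ x ∈ Finset.HasAntidiagonal.antidiagonal α,
        monoSign deg x.1 x.2 • (coeff (varDeriv A f) x.1 * coeff g x.2) =
      ∑ x ∈ Finset.HasAntidiagonal.antidiagonal (α + e),
        ((x.1 A : ℤ) * (monoSign deg e α * monoSign deg x.1 x.2)) •
          (coeff f x.1 * coeff g x.2) := by
    rw [sum_antidiagonal_add_single_left A α (fun x y =>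
      ((x A : ℤ) * (monoSign deg e α * monoSign deg x y)) • (coeff f x * coeff g y))
      (fun x y h => by simp [h])]
    refine Finset.sum_congr rfl fun x hx => ?_
    rw [coeff_varDeriv _ _ (admissible_of_mem hα hx).1, smul_mul_assoc, smul_smul]
    congr 1
    rw [← Finset.HasAntidiagonal.mem_antidiagonal.1 hx]
    simp only [monoSign_add_right, monoSign_add_left, Finsupp.add_apply, he,
      Finsupp.single_eq_same]
    push_cast
    linear_combination (-((x.1 A : ℤ) + 1) * monoSign deg (Finsupp.single A 1) x.1 *
      monoSign deg x.1 x.2) * monoSign_mul_self (deg := deg) (Finsupp.single A 1) x.2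
  have h2 : sgn (deg A) a • ∑ x ∈ Finset.HasAntidiagonal.antidiagonal α,
        monoSign deg x.1 x.2 • (coeff f x.1 * coeff (varDeriv A g) x.2) =
      ∑ x ∈ Finset.HasAntidiagonal.antidiagonal (α + e),
        ((sgn (deg A) (deg A) ^ x.1 A * x.2 A : ℤ) *
          (monoSign deg e α * monoSign deg x.1 x.2)) • (coeff f x.1 * coeff g x.2) := by
    rw [sum_antidiagonal_add_single_right A α (fun x y =>
      ((sgn (deg A) (deg A) ^ x A * y A : ℤ) * (monoSign deg e α * monoSign deg x y)) •
        (coeff f x * coeff g y))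
      (fun x y h => by simp [h]), Finset.smul_sum]
    refine Finset.sum_congr rfl fun x hx => ?_
    rw [coeff_varDeriv _ _ (admissible_of_mem hα hx).2, mul_smul_comm, smul_smul, smul_smul]
    by_cases hxa : monoDeg deg x.1 = a
    · congr 1
      rw [← Finset.HasAntidiagonal.mem_antidiagonal.1 hx, ← hxa]
      simp only [monoSign_add_right, Finsupp.add_apply, he, Finsupp.single_eq_same]
      push_cast
      have key := monoSign_single_mul (deg := deg) A x.1
      have s1 := monoSign_mul_self (deg := deg) x.1 (Finsupp.single A 1)
      have s2 := monoSign_mul_self (deg := deg) (Finsupp.single A 1) x.1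
      have s3 := sgn_mul_self (deg A) (monoDeg deg x.1)
      have s4 : sgn (deg A) (deg A) ^ x.1 A * sgn (deg A) (deg A) ^ x.1 A = 1 := by
        rw [← mul_pow, sgn_mul_self, one_pow]
      have key' : sgn (deg A) (monoDeg deg x.1) = sgn (deg A) (deg A) ^ x.1 A *
          (monoSign deg x.1 (Finsupp.single A 1) * monoSign deg (Finsupp.single A 1) x.1) := by
        rw [key]
        linear_combination (-sgn (deg A) (monoDeg deg x.1)) * s4
      rw [key']
      ring
    · rw [hf.coeff_eq_zero hxa]
      simp
  rw [hL, h1, h2, Finset.smul_sum, ← Finset.sum_add_distrib]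
  refine Finset.sum_congr rfl fun x hx => ?_
  rw [← add_smul, smul_smul]
  by_cases hadm : Admissible deg x.1 ∧ Admissible deg x.2
  · congr 1
    rw [← add_mul, varDeriv_count A hα (Finset.HasAntidiagonal.mem_antidiagonal.1 hx) hadm.1
      hadm.2]
    split_ifs
    · push_cast
      ring
    · simp
  · rcases not_and_or.1 hadm with h | h <;> simp [coeff_eq_zero_of_not h]

theorem coeff_const (r : R) (α : Fin N →₀ ℕ) :
    coeff (const r : Series deg R) α = if α = 0 then r else 0 := by
  by_cases h : Admissible deg α
  · exact coeff_coe (const r) ⟨α, h⟩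
  · have : α ≠ 0 := fun h0 => h (h0 ▸ admissible_zero)
    simp [coeff, h, this]

theorem admissible_single (A : Fin N) : Admissible deg (Finsupp.single A 1) := fun B _ => by
  by_cases h : B = A
  · subst h; simp
  · simp [Finsupp.single_eq_of_ne h]

theorem coeff_var (A : Fin N) (α : Fin N →₀ ℕ) :
    coeff (var A : Series deg R) α = if α = Finsupp.single A 1 then 1 else 0 := by
  by_cases h : Admissible deg α
  · exact coeff_coe (var A) ⟨α, h⟩
  · have : α ≠ Finsupp.single A 1 := fun h0 => h (h0 ▸ admissible_single A)
    simp [coeff, h, this]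

theorem varDeriv_const (A : Fin N) (r : R) : varDeriv A (const r : Series deg R) = 0 :=
  ext_coeff fun α hα => by
    rw [coeff_varDeriv _ _ hα, coeff_const, coeff_zero, if_neg, smul_zero]
    intro h
    simpa using DFunLike.congr_fun h A

theorem varDeriv_var (A B : Fin N) :
    varDeriv A (var B : Series deg R) = if A = B then 1 else 0 :=
  ext_coeff fun α hα => by
    rw [coeff_varDeriv _ _ hα, coeff_var]
    by_cases hAB : A = B
    · subst hAB
      rw [if_pos rfl, coeff_one]
      by_cases h : α = 0
      · subst h
        simp [monoSign_zero_right]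
      · rw [if_neg, if_neg h, smul_zero]
        intro h'
        exact h (by simpa using h')
    · rw [if_neg hAB, coeff_zero, if_neg, smul_zero]
      intro h
      have := DFunLike.congr_fun h A
      simp [Finsupp.single_eq_of_ne hAB] at this

/-- The quotient by `ξ^A` of the part of `f` in the monomials whose first variable is `ξ^A`. -/
def firstVarQuotient (A : Fin N) (f : Series deg R) : Series deg R := fun α =>
  open Classical in
  if ∀ B < A, α.1 B = 0 then coeff f (α.1 + Finsupp.single A 1) else 0

theorem coeff_var_mul (A : Fin N) (g : Series deg R) {α : Fin N →₀ ℕ} (hα : Admissible deg α) :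
    coeff (var A * g) α = if α A = 0 then 0 else
      monoSign deg (Finsupp.single A 1) (α - Finsupp.single A 1) •
        coeff g (α - Finsupp.single A 1) := by
  rw [coeff_mul _ _ hα]
  split_ifs with h
  · refine Finset.sum_eq_zero fun x hx => ?_
    rw [coeff_var, if_neg, zero_mul, smul_zero]
    intro h'
    have := DFunLike.congr_fun (Finset.HasAntidiagonal.mem_antidiagonal.1 hx) A
    simp [h', h] at this
  · have hle : Finsupp.single A 1 ≤ α := Finsupp.single_le_iff.2 (Nat.one_le_iff_ne_zero.2 h)
    rw [Finset.sum_eq_single (Finsupp.single A 1, α - Finsupp.single A 1)]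
    · simp [coeff_var]
    · rintro ⟨x, y⟩ hx hne
      rw [coeff_var, if_neg, zero_mul, smul_zero]
      rintro rfl
      refine hne ?_
      simp only [Finset.HasAntidiagonal.mem_antidiagonal] at hx
      simp [← hx]
    · intro hn
      exact absurd (Finset.HasAntidiagonal.mem_antidiagonal.2 (add_tsub_cancel_of_le hle)) hn

/-- Every power series is the sum of its constant term and of multiples of the variables. -/
theorem eq_const_add_sum_var_mul (f : Series deg R) :
    f = const (coeff f 0) + ∑ A, var A * firstVarQuotient A f := by
  refine ext_coeff fun α hα => ?_
  have hsum : ∀ s : Finset (Fin N), coeff (∑ A ∈ s, var A * firstVarQuotient A f) α =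
      ∑ A ∈ s, coeff (var A * firstVarQuotient A f) α := by
    intro s
    induction s using Finset.induction_on with
    | empty => simp [coeff_zero]
    | insert i s hi ih => rw [Finset.sum_insert hi, Finset.sum_insert hi, coeff_add, ih]
  rw [coeff_add, hsum, coeff_const]
  by_cases h0 : α = 0
  · subst h0
    simp [coeff_var_mul _ _ hα]
  rw [if_neg h0, zero_add]
  -- only the first variable of `ξ^α` contributes
  obtain ⟨A, hA, hmin⟩ : ∃ A, α A ≠ 0 ∧ ∀ B < A, α B = 0 := by
    have hne : (Finset.univ.filter fun A => α A ≠ 0).Nonempty := by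
      obtain ⟨A, hA⟩ := Finsupp.ne_iff.1 h0
      exact ⟨A, by simpa using hA⟩
    refine ⟨(Finset.univ.filter fun A => α A ≠ 0).min' hne, ?_, fun B hB => ?_⟩
    · simpa using Finset.min'_mem _ hne
    · by_contra h
      exact absurd (Finset.min'_le _ B (by simpa using h)) (not_le.2 hB)
  have hle : ∀ {B}, α B ≠ 0 → Finsupp.single B 1 ≤ α := fun h =>
    Finsupp.single_le_iff.2 (Nat.one_le_iff_ne_zero.2 h)
  have hq : ∀ B, α B ≠ 0 → Admissible deg (α - Finsupp.single B 1) := fun B hB =>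
    (admissible_of_mem hα (x := (Finsupp.single B 1, α - Finsupp.single B 1))
      (Finset.HasAntidiagonal.mem_antidiagonal.2 (add_tsub_cancel_of_le (hle hB)))).2
  rw [Finset.sum_eq_single A]
  · rw [coeff_var_mul _ _ hα, if_neg hA]
    have hsign : monoSign deg (Finsupp.single A 1) (α - Finsupp.single A 1) = 1 := by
      refine Finset.prod_eq_one fun C _ => Finset.prod_eq_one fun B _ => ?_
      split_ifs with hBC
      · by_cases hC : C = A
        · subst hC
          simp [hmin B hBC]
        · simp [Finsupp.single_eq_of_ne hC]
      · rfl
    rw [hsign, one_smul, show coeff (firstVarQuotient A f) (α - Finsupp.single A 1) = _ from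
      coeff_coe (firstVarQuotient A f) ⟨_, hq A hA⟩, firstVarQuotient, if_pos,
      tsub_add_cancel_of_le (hle hA)]
    intro B hB
    simp [hmin B hB]
  · intro B _ hB
    rw [coeff_var_mul _ _ hα]
    split_ifs with h
    · rfl
    rw [show coeff (firstVarQuotient B f) (α - Finsupp.single B 1) = _ from
      coeff_coe (firstVarQuotient B f) ⟨_, hq B h⟩, firstVarQuotient, if_neg, smul_zero]
    intro hall
    rcases lt_trichotomy A B with hAB | hAB | hAB
    · have := hall A hAB
      simp [Finsupp.single_eq_of_ne hAB.ne] at this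
      exact hA this
    · exact hB hAB.symm
    · exact h (hmin B hAB)
  · simp

end Series

/-! ### Smooth functions and Hadamard's lemma -/

section SmoothCalculus

open scoped ContDiff

variable {p : ℕ}

/-- Averages of a smooth function over the segments from `x₀` to `x` depend smoothly on `x`: such an
average is the value at zero of a convolution with a smooth parameter. -/
theorem contDiff_integral_segment {f : (Fin p → ℝ) → ℝ} (hf : ContDiff ℝ ∞ f) (x₀ : Fin p → ℝ) :
    ContDiff ℝ ∞ fun x => ∫ t in (0 : ℝ)..1, f (x₀ + t • (x - x₀)) := by
  let φ : ContDiffBump (0 : ℝ) := ⟨1, 2, one_pos, one_lt_two⟩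
  let g : (Fin p → ℝ) → ℝ → ℝ := fun x s => φ s * f (x₀ - s • (x - x₀))
  have hg : ContDiff ℝ ∞ (Function.uncurry g) := by
    refine ContDiff.mul (φ.contDiff.comp contDiff_snd) (hf.comp ?_)
    exact contDiff_const.sub (contDiff_snd.smul (contDiff_fst.sub contDiff_const))
  have hloc : MeasureTheory.LocallyIntegrable ((Set.Ioc (0 : ℝ) 1).indicator fun _ => (1 : ℝ)) := by
    refine MeasureTheory.Integrable.locallyIntegrable ?_
    exact (MeasureTheory.integrable_indicator_iff measurableSet_Ioc).2
      (MeasureTheory.integrableOn_const (by simp))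
  have key := MeasureTheory.contDiffOn_convolution_right_with_param_comp (n := (⊤ : ℕ∞))
    (μ := MeasureTheory.volume) (ContinuousLinearMap.lsmul ℝ ℝ)
    (s := (Set.univ : Set (Fin p → ℝ))) (v := fun _ => (0 : ℝ)) contDiffOn_const
    (g := g) (k := Metric.closedBall (0 : ℝ) 2) isOpen_univ (isCompact_closedBall _ _)
    (fun x s _ hs => by
      have : φ s = 0 := φ.zero_of_le_dist (by
        have := hs; simp only [Metric.mem_closedBall, not_le] at this; exact this.le)
      simp [g, this]) hloc hg.contDiffOn
  rw [contDiffOn_univ] at key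
  convert! key using 1
  ext x
  rw [MeasureTheory.convolution, intervalIntegral.integral_of_le zero_le_one,
    ← MeasureTheory.integral_indicator measurableSet_Ioc]
  refine MeasureTheory.integral_congr_ae (Filter.Eventually.of_forall fun t => ?_)
  by_cases ht : t ∈ Set.Ioc (0 : ℝ) 1
  · have h1 : φ (-t) = 1 := φ.one_of_mem_closedBall (by
      simp only [Metric.mem_closedBall, dist_zero_right, norm_neg, Real.norm_eq_abs]
      rw [abs_of_pos ht.1]; exact ht.2)
    simp [g, ht, h1]
  · simp [ht]

/-- Hadamard's lemma for smooth functions on `ℝ^p`. -/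
theorem exists_eq_add_sum_of_contDiff {f : (Fin p → ℝ) → ℝ} (hf : ContDiff ℝ ∞ f)
    (x₀ : Fin p → ℝ) : ∃ g : Fin p → (Fin p → ℝ) → ℝ, (∀ a, ContDiff ℝ ∞ (g a)) ∧
      ∀ x, f x = f x₀ + ∑ a, (x a - x₀ a) * g a x := by
  have hd : ContDiff ℝ ∞ (fderiv ℝ f) := hf.fderiv_right (m := ∞) (by simp)
  have hda : ∀ a, ContDiff ℝ ∞ fun y => fderiv ℝ f y (Pi.single a 1) := fun a =>
    hd.clm_apply contDiff_const
  refine ⟨fun a x => ∫ t in (0 : ℝ)..1, fderiv ℝ f (x₀ + t • (x - x₀)) (Pi.single a 1),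
    fun a => contDiff_integral_segment (hda a) x₀, fun x => ?_⟩
  have hderiv : ∀ t : ℝ, HasDerivAt (fun t : ℝ => f (x₀ + t • (x - x₀)))
      (∑ a, (x a - x₀ a) * fderiv ℝ f (x₀ + t • (x - x₀)) (Pi.single a 1)) t := by
    intro t
    have h1 : HasDerivAt (fun t : ℝ => x₀ + t • (x - x₀)) (x - x₀) t := by
      simpa using ((hasDerivAt_id t).smul_const (x - x₀)).const_add x₀
    have h2 := ((hf.differentiable (by simp)) (x₀ + t • (x - x₀))).hasFDerivAt.comp_hasDerivAt t h1
    convert! h2 using 1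
    generalize fderiv ℝ f (x₀ + t • (x - x₀)) = L
    conv_rhs => rw [pi_eq_sum_univ' (x - x₀)]
    rw [map_sum]
    refine Finset.sum_congr rfl fun a _ => ?_
    rw [map_smul, smul_eq_mul, Pi.sub_apply]
  have hint := intervalIntegral.integral_eq_sub_of_hasDerivAt (a := 0) (b := 1)
    (fun t _ => hderiv t) (Continuous.intervalIntegrable (by fun_prop) _ _)
  rw [intervalIntegral.integral_finsetSum (fun a _ =>
    Continuous.intervalIntegrable (by fun_prop) _ _)] at hint
  simp only [intervalIntegral.integral_const_mul] at hint
  rw [hint]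
  simp

end SmoothCalculus

namespace Smooth

open scoped ContDiff

variable {p : ℕ} {V V' : Opens (Fin p → ℝ)}

theorem contDiffAt (f : Smooth V) (x : V) : ContDiffAt ℝ ∞ (extend f.1) x.1 :=
  ContDiffOn.contDiffAt f.2 (V.2.mem_nhds x.2)

theorem differentiableAt (f : Smooth V) (x : V) : DifferentiableAt ℝ (extend f.1) x.1 :=
  (contDiffAt f x).differentiableAt (by simp)

theorem extend_eventuallyEq {f : V → ℝ} {g : (Fin p → ℝ) → ℝ} (x : V) (h : ∀ y : V, f y = g y) :
    extend f =ᶠ[nhds x.1] g :=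
  Filter.eventuallyEq_of_mem (V.2.mem_nhds x.2) fun y hy =>
    (extend_apply f ⟨y, hy⟩).trans (h ⟨y, hy⟩)

/-- The restriction to `V` of a smooth function on `ℝ^p`. -/
def ofContDiff (V : Opens (Fin p → ℝ)) {g : (Fin p → ℝ) → ℝ} (hg : ContDiff ℝ ∞ g) : Smooth V :=
  ⟨fun x => g x.1, hg.contDiffOn.congr fun x hx => extend_apply _ (⟨x, hx⟩ : V)⟩

theorem partialDeriv_add (a : Fin p) (f g : Smooth V) :
    partialDeriv a (f + g) = partialDeriv a f + partialDeriv a g := by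
  ext x
  change fderiv ℝ (extend (f.1 + g.1)) x.1 _ = fderiv ℝ _ _ _ + fderiv ℝ _ _ _
  rw [(extend_eventuallyEq (g := extend f.1 + extend g.1) x fun y => by
    simp [extend_apply]).fderiv_eq, fderiv_add (differentiableAt f x) (differentiableAt g x)]
  rfl

theorem partialDeriv_smul (a : Fin p) (r : ℝ) (f : Smooth V) :
    partialDeriv a (r • f) = r • partialDeriv a f := by
  ext x
  change fderiv ℝ (extend (r • f.1)) x.1 _ = r • fderiv ℝ _ _ _
  rw [(extend_eventuallyEq (g := r • extend f.1) x fun y => by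
    simp [extend_apply]).fderiv_eq, fderiv_const_smul (differentiableAt f x)]
  rfl

theorem partialDeriv_mul (a : Fin p) (f g : Smooth V) :
    partialDeriv a (f * g) = partialDeriv a f * g + f * partialDeriv a g := by
  ext x
  change fderiv ℝ (extend (f.1 * g.1)) x.1 _ =
    fderiv ℝ _ _ _ * g.1 x + f.1 x * fderiv ℝ _ _ _
  rw [(extend_eventuallyEq (g := extend f.1 * extend g.1) x fun y => by
    simp [extend_apply]).fderiv_eq, fderiv_mul (differentiableAt f x) (differentiableAt g x)]
  simp only [add_apply, smul_apply, smul_eq_mul,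
    extend_apply]
  ring

theorem partialDeriv_restrict (h : V' ≤ V) (a : Fin p) (f : Smooth V) :
    partialDeriv a (restrict h f) = restrict h (partialDeriv a f) := by
  ext x
  change fderiv ℝ (extend (restrict h f).1) x.1 _ = fderiv ℝ (extend f.1) x.1 _
  rw [(extend_eventuallyEq (f := (restrict h f).1) (g := extend f.1) x fun y =>
    (extend_apply f.1 ⟨y.1, h y.2⟩).symm).fderiv_eq]

theorem partialDeriv_coord (a b : Fin p) :
    partialDeriv a (coord V b) = if a = b then 1 else 0 := by
  ext x
  change fderiv ℝ (extend (coord V b).1) x.1 _ = _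
  rw [(extend_eventuallyEq (f := (coord V b).1) (g := fun y => ContinuousLinearMap.proj (R := ℝ) b y) x
    fun y => rfl).fderiv_eq, ContinuousLinearMap.fderiv]
  by_cases hab : a = b
  · subst hab; simp
  · simp [hab]

/-- The partial derivative as a linear map. -/
def partialDerivₗ (a : Fin p) : Smooth V →ₗ[ℝ] Smooth V where
  toFun := partialDeriv a
  map_add' := partialDeriv_add a
  map_smul' := partialDeriv_smul a

theorem partialDeriv_zero (a : Fin p) : partialDeriv a (0 : Smooth V) = 0 :=
  (partialDerivₗ a).map_zero

theorem partialDeriv_one (a : Fin p) : partialDeriv a (1 : Smooth V) = 0 := by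
  have h := partialDeriv_mul a (1 : Smooth V) 1
  rw [mul_one, mul_one, one_mul] at h
  exact left_eq_add.1 h

/-- The restriction of smooth functions as an algebra homomorphism. -/
def restrictₐ (h : V' ≤ V) : Smooth V →ₐ[ℝ] Smooth V' where
  toFun := restrict h
  map_one' := rfl
  map_mul' _ _ := rfl
  map_zero' := rfl
  map_add' _ _ := rfl
  commutes' _ := rfl

/-- Hadamard's lemma on a small ball around a point of `V`. -/
theorem exists_restrict_eq (f : Smooth V) (x₀ : V) : ∃ r > 0,
    ∀ (V' : Opens (Fin p → ℝ)) (h : V' ≤ V), (V' : Set (Fin p → ℝ)) ⊆ Metric.ball x₀.1 r →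
      ∃ g : Fin p → Smooth V', restrict h f =
        algebraMap ℝ _ (f.1 x₀) + ∑ a, (coord V' a - algebraMap ℝ _ (x₀.1 a)) * g a := by
  obtain ⟨R, hR, hRV⟩ := Metric.nhds_basis_closedBall.mem_iff.1 (V.2.mem_nhds x₀.2)
  -- extend `f`, near `x₀`, to a smooth function on all of `ℝ^p`
  let χ : ContDiffBump x₀.1 := ⟨R / 2, R, half_pos hR, half_lt_self hR⟩
  have hχ : ContDiff ℝ ∞ fun x => χ x * extend f.1 x := by
    rw [contDiff_iff_contDiffAt]
    intro x
    by_cases hx : x ∈ Metric.closedBall x₀.1 R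
    · exact χ.contDiff.contDiffAt.mul (contDiffAt f ⟨x, hRV hx⟩)
    · have hev : (fun x => χ x * extend f.1 x) =ᶠ[nhds x] fun _ => 0 := by
        filter_upwards [Metric.isClosed_closedBall.isOpen_compl.mem_nhds hx] with y hy
        have : χ y = 0 := χ.zero_of_le_dist (by
          simp only [Set.mem_compl_iff, Metric.mem_closedBall, not_le] at hy; exact hy.le)
        simp [this]
      exact contDiffAt_const.congr_of_eventuallyEq hev
  obtain ⟨g, hg, hfg⟩ := exists_eq_add_sum_of_contDiff hχ x₀.1
  refine ⟨R / 2, half_pos hR, fun V' h hV' => ⟨fun a => ofContDiff V' (hg a), ?_⟩⟩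
  have hone : ∀ x ∈ Metric.ball x₀.1 (R / 2), χ x = 1 := fun x hx =>
    χ.one_of_mem_closedBall (Metric.ball_subset_closedBall hx)
  ext x
  have hx := hfg x.1
  simp only [hone x.1 (hV' x.2), hone x₀.1 (Metric.mem_ball_self (half_pos hR)), one_mul,
    extend_apply f.1 x₀] at hx
  change f.1 ⟨x.1, h x.2⟩ = _
  rw [← extend_apply f.1 ⟨x.1, h x.2⟩, hx]
  simp only [Subalgebra.coe_add, Subalgebra.coe_algebraMap, Pi.add_apply, Pi.algebraMap_apply,
    AddSubmonoidClass.coe_finsetSum, Finset.sum_apply]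
  rfl

end Smooth

/-! ### Calculus on `ℤ₂ⁿ`-domains -/

namespace Model

variable {n p N : ℕ} {deg : Fin N → Deg n} {V V' : Opens (Fin p → ℝ)}

theorem coeff_restrict (h : V' ≤ V) (f : Model deg V) (α : Fin N →₀ ℕ) :
    Series.coeff (restrict h f) α = Smooth.restrict h (Series.coeff f α) := by
  by_cases hα : Admissible deg α
  · exact (Series.coeff_coe (restrict h f) ⟨α, hα⟩).trans
      (congrArg _ (Series.coeff_coe f ⟨α, hα⟩).symm)
  · rw [Series.coeff_eq_zero_of_not hα, Series.coeff_eq_zero_of_not hα]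
    rfl

theorem coeff_partialDeriv_inl (a : Fin p) (f : Model deg V) (α : Fin N →₀ ℕ) :
    Series.coeff (partialDeriv (Sum.inl a) f) α = Smooth.partialDeriv a (Series.coeff f α) := by
  by_cases hα : Admissible deg α
  · exact (Series.coeff_coe (partialDeriv (Sum.inl a) f) ⟨α, hα⟩).trans
      (congrArg (Smooth.partialDeriv a) (Series.coeff_coe f ⟨α, hα⟩).symm)
  · rw [Series.coeff_eq_zero_of_not hα, Series.coeff_eq_zero_of_not hα, Smooth.partialDeriv_zero]

theorem partialDeriv_inr (A : Fin N) (f : Model deg V) :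
    partialDeriv (Sum.inr A) f = Series.varDeriv A f := rfl

theorem partialDeriv_add (I : Fin p ⊕ Fin N) (f g : Model deg V) :
    partialDeriv I (f + g) = partialDeriv I f + partialDeriv I g := by
  rcases I with a | A
  · refine Series.ext_coeff fun α _ => ?_
    simp only [Series.coeff_add, coeff_partialDeriv_inl, Smooth.partialDeriv_add]
  · exact Series.varDeriv_add A f g

theorem partialDeriv_smul (I : Fin p ⊕ Fin N) (r : ℝ) (f : Model deg V) :
    partialDeriv I (r • f) = r • partialDeriv I f := by
  rcases I with a | A
  · refine Series.ext_coeff fun α _ => ?_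
    simp only [Series.coeff_smul, coeff_partialDeriv_inl, Smooth.partialDeriv_smul]
  · exact Series.varDeriv_smul A r f

theorem partialDeriv_isHomogeneous (I : Fin p ⊕ Fin N) {f : Model deg V} {a : Deg n}
    (hf : f.IsHomogeneous a) :
    (partialDeriv I f : Model deg V).IsHomogeneous (coordDeg deg I + a) := by
  rcases I with b | A
  · intro α h
    change Smooth.partialDeriv b (f α) = 0
    rw [hf α (by simpa [coordDeg] using h), Smooth.partialDeriv_zero]
  · exact Series.varDeriv_isHomogeneous A hf

theorem partialDeriv_mul (I : Fin p ⊕ Fin N) {f : Model deg V} {a : Deg n}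
    (hf : f.IsHomogeneous a) (g : Model deg V) :
    partialDeriv I (f * g) =
      partialDeriv I f * g + sgn (coordDeg deg I) a • (f * partialDeriv I g) := by
  rcases I with b | A
  · rw [show coordDeg deg (Sum.inl b : Fin p ⊕ Fin N) = 0 from rfl, sgn_zero_left, one_smul]
    refine Series.ext_coeff fun α hα => ?_
    rw [coeff_partialDeriv_inl, Series.coeff_add, Series.coeff_mul _ _ hα, Series.coeff_mul _ _ hα,
      Series.coeff_mul _ _ hα, ← Finset.sum_add_distrib]
    refine (map_sum (Smooth.partialDerivₗ b) _ _).trans (Finset.sum_congr rfl fun x _ => ?_)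
    rw [map_zsmul, ← smul_add, coeff_partialDeriv_inl, coeff_partialDeriv_inl]
    exact congrArg _ (Smooth.partialDeriv_mul b _ _)
  · exact Series.varDeriv_mul A hf g

theorem partialDeriv_restrict (h : V' ≤ V) (I : Fin p ⊕ Fin N) (f : Model deg V) :
    partialDeriv I (restrict h f) = restrict h (partialDeriv I f) := by
  refine Series.ext_coeff fun α hα => ?_
  rcases I with a | A
  · rw [coeff_partialDeriv_inl, coeff_restrict, coeff_restrict, coeff_partialDeriv_inl,
      Smooth.partialDeriv_restrict]
  · rw [coeff_restrict, partialDeriv_inr, partialDeriv_inr, Series.coeff_varDeriv _ _ hα,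
      Series.coeff_varDeriv _ _ hα, coeff_restrict]
    exact (map_zsmul (Smooth.restrictₐ h) _ _).symm

theorem coord_isHomogeneous (I : Fin p ⊕ Fin N) :
    (coord V I : Model deg V).IsHomogeneous (coordDeg deg I) := by
  rcases I with a | A
  · exact Series.const_isHomogeneous _
  · exact Series.var_isHomogeneous A

theorem restrict_const (h : V' ≤ V) (r : Smooth V) :
    restrict h (Series.const r : Model deg V) = Series.const (Smooth.restrict h r) := by
  refine Series.ext_coeff fun α _ => ?_
  rw [coeff_restrict, Series.coeff_const, Series.coeff_const]
  split_ifs <;> rfl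

theorem restrict_coord (h : V' ≤ V) (I : Fin p ⊕ Fin N) :
    restrict h (coord V I : Model deg V) = coord V' I := by
  rcases I with a | A
  · exact restrict_const h _
  · refine Series.ext_coeff fun α _ => ?_
    rw [coeff_restrict]
    change Smooth.restrict h (Series.coeff (Series.var A) α) = Series.coeff (Series.var A) α
    rw [Series.coeff_var, Series.coeff_var]
    split_ifs <;> rfl

theorem partialDeriv_coord (I J : Fin p ⊕ Fin N) :
    partialDeriv I (coord V J : Model deg V) = if I = J then 1 else 0 := by
  rcases I with a | A <;> rcases J with b | B
  · refine Series.ext_coeff fun α _ => ?_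
    rw [coeff_partialDeriv_inl]
    change Smooth.partialDeriv a (Series.coeff (Series.const _) α) = _
    simp only [Series.coeff_const, Sum.inl.injEq]
    by_cases hα : α = 0
    · rw [if_pos hα, Smooth.partialDeriv_coord]
      split_ifs
      · rw [Series.coeff_one, if_pos hα]
      · rw [Series.coeff_zero]
    · rw [if_neg hα, Smooth.partialDeriv_zero]
      split_ifs
      · rw [Series.coeff_one, if_neg hα]
      · rw [Series.coeff_zero]
  · refine Series.ext_coeff fun α _ => ?_
    rw [coeff_partialDeriv_inl]
    change Smooth.partialDeriv a (Series.coeff (Series.var B) α) = _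
    rw [Series.coeff_var, if_neg Sum.inl_ne_inr, Series.coeff_zero]
    split_ifs
    · exact Smooth.partialDeriv_one a
    · exact Smooth.partialDeriv_zero a
  · rw [if_neg (by simp)]
    exact Series.varDeriv_const A _
  · simp only [Sum.inr.injEq]
    exact Series.varDeriv_var A B

/-- The inclusion of the functions of the base coordinates. -/
def constₗ : Smooth V →ₗ[ℝ] Model deg V where
  toFun := Series.const
  map_add' r s := Series.ext_coeff fun α _ => by
    simp only [Series.coeff_add, Series.coeff_const]; split_ifs <;> simp
  map_smul' r s := Series.ext_coeff fun α _ => by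
    simp only [RingHom.id_apply, Series.coeff_smul, Series.coeff_const]; split_ifs <;> simp

theorem const_mul (r s : Smooth V) :
    (Series.const (r * s) : Model deg V) = Series.const r * Series.const s := by
  refine Series.ext_coeff fun α hα => ?_
  rw [Series.coeff_mul _ _ hα, Series.coeff_const]
  split_ifs with h
  · subst h
    simp [Series.monoSign_zero_left, Series.coeff_const]
  · refine (Finset.sum_eq_zero fun x hx => ?_).symm
    rw [Series.coeff_const, Series.coeff_const]
    split_ifs with h1 h2
    · refine absurd ?_ h
      rw [← Finset.HasAntidiagonal.mem_antidiagonal.1 hx, h1, h2, add_zero]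
    all_goals simp

theorem const_algebraMap (r : ℝ) :
    (Series.const (algebraMap ℝ (Smooth V) r) : Model deg V) = algebraMap ℝ _ r := by
  rw [Algebra.algebraMap_eq_smul_one, Algebra.algebraMap_eq_smul_one]
  refine (constₗ.map_smul r (1 : Smooth V)).trans ?_
  rfl

/-- Near every point `x₀`, a function on a `ℤ₂ⁿ`-domain is the sum of a constant and of multiples
of the functions `x^a - x₀^a` and `ξ^A`. -/
theorem exists_restrict_eq (f : Model deg V) (x₀ : V) : ∃ r > 0,
    ∀ (V' : Opens (Fin p → ℝ)) (h : V' ≤ V), (V' : Set (Fin p → ℝ)) ⊆ Metric.ball x₀.1 r →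
      ∃ (t : ℝ) (g : Fin p ⊕ Fin N → Model deg V'), restrict h f =
        algebraMap ℝ _ t +
          (∑ a, (coord V' (Sum.inl a) - algebraMap ℝ _ (x₀.1 a)) * g (Sum.inl a) +
            ∑ A, coord V' (Sum.inr A) * g (Sum.inr A)) := by
  obtain ⟨r, hr, H⟩ := Smooth.exists_restrict_eq (Series.coeff f 0) x₀
  refine ⟨r, hr, fun V' h hV' => ?_⟩
  obtain ⟨g, hg⟩ := H V' h hV'
  refine ⟨(Series.coeff f 0).1 x₀, Sum.elim (fun a => Series.const (g a))
    (fun A => Series.firstVarQuotient A (restrict h f)), ?_⟩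
  have hconst : (Series.const (Series.coeff (restrict h f) 0) : Model deg V') =
      algebraMap ℝ _ ((Series.coeff f 0).1 x₀) +
        ∑ a, (coord V' (Sum.inl a) - algebraMap ℝ _ (x₀.1 a)) * Series.const (g a) := by
    rw [coeff_restrict, hg, ← const_algebraMap]
    refine ((constₗ (deg := deg) (V := V')).map_add _ _).trans (congrArg _ ?_)
    refine (map_sum (constₗ (deg := deg) (V := V')) _ _).trans
      (Finset.sum_congr rfl fun a _ => ?_)
    refine (const_mul _ _).trans (congrArg (· * _) ?_)
    rw [← const_algebraMap]
    exact (constₗ (deg := deg) (V := V')).map_sub _ _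
  rw [← add_assoc]
  refine (Series.eq_const_add_sum_var_mul (restrict h f)).trans ?_
  exact congrArg (· + _) hconst

end Model

/-! ### Sections, restrictions and gradings -/

namespace LocallyRingedSpace

variable {n : ℕ} {S : LocallyRingedSpace.{u} n}

theorem res_res {U V W : Opens S.carrier} (h : V ≤ U) (h' : W ≤ V) (s : S.Sec U) :
    res h' (res h s) = res (h'.trans h) s := by
  have := S.presheaf.map_comp (homOfLE h).op (homOfLE h').op
  exact (congrArg (fun φ => φ.hom s) this).symm

theorem res_self {U : Opens S.carrier} (h : U ≤ U) (s : S.Sec U) : res h s = s :=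
  congrArg (fun φ => φ.hom s) (S.presheaf.map_id (op U))

theorem res_injective {U V : Opens S.carrier} (h : V ≤ U) (h' : U ≤ V) :
    Function.Injective (res (S := S) h) := fun s t hst => by
  simpa only [res_res, res_self] using congrArg (res h') hst

theorem res_mem {U V : Opens S.carrier} (h : V ≤ U) {a : Deg n} {s : S.Sec U}
    (hs : s ∈ S.grading U a) : res h s ∈ S.grading V a :=
  S.map_mem (homOfLE h) a s hs

theorem hom_ext {U : Opens S.carrier} {G : Type*} [AddCommGroup G] {φ ψ : S.Sec U →+ G}
    (h : ∀ a, ∀ s ∈ S.grading U a, φ s = ψ s) (s : S.Sec U) : φ s = ψ s := by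
  induction s using DirectSum.Decomposition.inductionOn (S.grading U) with
  | zero => rw [map_zero, map_zero]
  | homogeneous s => exact h _ s.1 s.2
  | add s t hs ht => rw [map_add, map_add, hs, ht]

theorem proj_of_mem {U : Opens S.carrier} {a : Deg n} {s : S.Sec U} (hs : s ∈ S.grading U a)
    (b : Deg n) : GradedRing.proj (S.grading U) b s = if a = b then s else 0 := by
  rw [GradedRing.proj_apply]
  split_ifs with h
  · subst h
    exact DirectSum.decompose_of_mem_same _ hs
  · exact DirectSum.decompose_of_mem_ne _ hs h

theorem proj_mem {U : Opens S.carrier} (a : Deg n) (s : S.Sec U) :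
    GradedRing.proj (S.grading U) a s ∈ S.grading U a := by
  rw [GradedRing.proj_apply]
  exact SetLike.coe_mem _

theorem mem_of_proj_eq {U : Opens S.carrier} {a : Deg n} {s : S.Sec U}
    (h : GradedRing.proj (S.grading U) a s = s) : s ∈ S.grading U a := h ▸ proj_mem a s

theorem sum_proj {U : Opens S.carrier} (s : S.Sec U) :
    ∑ a, GradedRing.proj (S.grading U) a s = s := by
  have := hom_ext (φ := ∑ a, GradedRing.proj (S.grading U) a) (ψ := AddMonoidHom.id _)
    (fun a s hs => by
      rw [AddMonoidHom.finsetSum_apply]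
      simp [proj_of_mem hs]) s
  rwa [AddMonoidHom.finsetSum_apply] at this

theorem res_proj {U V : Opens S.carrier} (h : V ≤ U) (a : Deg n) (s : S.Sec U) :
    res h (GradedRing.proj (S.grading U) a s) = GradedRing.proj (S.grading V) a (res h s) :=
  hom_ext (φ := (res h).toRingHom.toAddMonoidHom.comp (GradedRing.proj (S.grading U) a))
    (ψ := (GradedRing.proj (S.grading V) a).comp (res h).toRingHom.toAddMonoidHom)
    (fun b s hs => by
      change res h (GradedRing.proj (S.grading U) a s) = GradedRing.proj (S.grading V) a (res h s)
      rw [proj_of_mem hs, proj_of_mem (res_mem h hs)]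
      split_ifs
      · rfl
      · exact map_zero _) s

theorem proj_mul_of_mem_left {U : Opens S.carrier} {a : Deg n} {s : S.Sec U}
    (hs : s ∈ S.grading U a) (b : Deg n) (t : S.Sec U) :
    GradedRing.proj (S.grading U) (a + b) (s * t) = s * GradedRing.proj (S.grading U) b t := by
  simp only [GradedRing.proj_apply]
  exact DirectSum.coe_decompose_mul_add_of_left_mem (S.grading U) hs

theorem one_mem (U : Opens S.carrier) : (1 : S.Sec U) ∈ S.grading U 0 :=
  SetLike.one_mem_graded (S.grading U)

theorem algebraMap_mem (U : Opens S.carrier) (r : ℝ) :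
    algebraMap ℝ (S.Sec U) r ∈ S.grading U 0 := by
  rw [Algebra.algebraMap_eq_smul_one]
  exact Submodule.smul_mem _ r (one_mem U)

theorem mul_mem {U : Opens S.carrier} {a b : Deg n} {s t : S.Sec U} (hs : s ∈ S.grading U a)
    (ht : t ∈ S.grading U b) : s * t ∈ S.grading U (a + b) :=
  SetLike.mul_mem_graded hs ht

/-! ### The sign twist -/

theorem twist_of_mem {U : Opens S.carrier} (b : Deg n) {a : Deg n} {f : S.Sec U}
    (hf : f ∈ S.grading U a) : twist b f = sgn b a • f := by
  simp [twist, proj_of_mem hf]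

theorem twist_mem {U : Opens S.carrier} (b : Deg n) {a : Deg n} {f : S.Sec U}
    (hf : f ∈ S.grading U a) : twist b f ∈ S.grading U a := by
  rw [twist_of_mem b hf]
  exact zsmul_mem hf _

/-- The twist as an additive map. -/
def twistHom {U : Opens S.carrier} (b : Deg n) : S.Sec U →+ S.Sec U where
  toFun := twist b
  map_zero' := by simp [twist]
  map_add' f g := by simp [twist, Finset.sum_add_distrib]

theorem twistHom_apply {U : Opens S.carrier} (b : Deg n) (f : S.Sec U) :
    twistHom b f = twist b f := rfl

theorem twist_sum {U : Opens S.carrier} (b : Deg n) {ι : Type*} (s : Finset ι) (f : ι → S.Sec U) :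
    twist b (∑ i ∈ s, f i) = ∑ i ∈ s, twist b (f i) := map_sum (twistHom b) f s

theorem twist_zero_deg {U : Opens S.carrier} (f : S.Sec U) : twist 0 f = f :=
  hom_ext (φ := twistHom 0) (ψ := AddMonoidHom.id _) (fun a s hs => by
    simp [twistHom_apply, twist_of_mem 0 hs, sgn_zero_left]) f

theorem twist_twist {U : Opens S.carrier} (b : Deg n) (f : S.Sec U) : twist b (twist b f) = f :=
  hom_ext (φ := (twistHom b).comp (twistHom b)) (ψ := AddMonoidHom.id _) (fun a s hs => by
    simp only [AddMonoidHom.comp_apply, twistHom_apply, AddMonoidHom.id_apply]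
    rw [twist_of_mem b (twist_mem b hs), twist_of_mem b hs, smul_smul, sgn_mul_self, one_smul]) f

/-- Moving `f` past a homogeneous element twists `f`. -/
theorem mul_eq_mul_twist {U : Opens S.carrier} {b : Deg n} {t : S.Sec U} (ht : t ∈ S.grading U b)
    (f : S.Sec U) : f * t = t * twist b f :=
  hom_ext (φ := AddMonoidHom.mulRight t) (ψ := (AddMonoidHom.mulLeft t).comp (twistHom b))
    (fun a s hs => by
      change s * t = t * twist b s
      rw [twist_of_mem b hs, S.mul_comm_sgn U a b s t hs ht, mul_smul_comm, sgn_comm]) f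

theorem twist_mul {U : Opens S.carrier} (b : Deg n) (f g : S.Sec U) :
    twist b (f * g) = twist b f * twist b g :=
  hom_ext (φ := (twistHom b).comp (AddMonoidHom.mulRight g))
    (ψ := (AddMonoidHom.mulRight (twist b g)).comp (twistHom b))
    (fun a s hs => hom_ext (φ := (twistHom b).comp (AddMonoidHom.mulLeft s))
      (ψ := (AddMonoidHom.mulLeft (twist b s)).comp (twistHom b)) (fun c t ht => by
        change twist b (s * t) = twist b s * twist b t
        rw [twist_of_mem b (mul_mem hs ht), twist_of_mem b hs, twist_of_mem b ht, sgn_add_right,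
          smul_mul_smul_comm]) g) f

theorem twist_twist_deg {U : Opens S.carrier} (b c : Deg n) (f : S.Sec U) :
    twist b (twist c f) = twist (b + c) f :=
  hom_ext (φ := (twistHom b).comp (twistHom c)) (ψ := twistHom (b + c)) (fun a s hs => by
    simp only [AddMonoidHom.comp_apply, twistHom_apply]
    rw [twist_of_mem b (twist_mem c hs), twist_of_mem c hs, twist_of_mem _ hs, smul_smul,
      sgn_add_left]) f

theorem twist_mul_eq_mul_twist {U : Opens S.carrier} {b c d : Deg n} {t : S.Sec U}
    (ht : t ∈ S.grading U d) (h : b + d = c) (f : S.Sec U) : twist b f * t = t * twist c f := by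
  rw [mul_eq_mul_twist ht, twist_twist_deg, add_comm d b, h]

theorem res_twist {U V : Opens S.carrier} (h : V ≤ U) (b : Deg n) (f : S.Sec U) :
    res h (twist b f) = twist b (res h f) := by
  simp only [twist, map_sum, map_zsmul, res_proj]

/-! ### Partial derivatives in a chart -/

namespace Chart

variable {p N : ℕ} {deg : Fin N → Deg n} (c : S.Chart (p := p) deg)

theorem iso_isHomogeneous_iff {W : Opens S.carrier} (hW : W ≤ c.dom) (a : Deg n) (s : S.Sec W) :
    (c.iso W hW s).IsHomogeneous a ↔ s ∈ S.grading W a := by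
  refine ⟨fun h => mem_of_proj_eq ?_, c.iso_isHomogeneous W hW a s⟩
  refine (c.iso W hW).injective (funext fun α => ?_)
  have hp : ∀ b, (c.iso W hW (GradedRing.proj (S.grading W) b s)).IsHomogeneous b := fun b =>
    c.iso_isHomogeneous W hW b _ (proj_mem b s)
  by_cases hα : monoDeg deg α.1 = a
  · have hs : c.iso W hW s = ∑ b, c.iso W hW (GradedRing.proj (S.grading W) b s) := by
      rw [← map_sum, sum_proj]
    rw [hs]
    refine Eq.trans ?_ (Finset.sum_apply (M := fun _ => Smooth (imageOpens c.homeo W)) α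
      Finset.univ _).symm
    rw [Finset.sum_eq_single a]
    · intro b _ hb
      exact hp b α (fun h' => hb (h'.symm.trans hα))
    · simp
  · rw [hp a α hα, h α hα]

/-- The partial derivative `∂/∂x^I` as a linear map. -/
def partialDerivₗ {W : Opens S.carrier} (hW : W ≤ c.dom) (I : Fin p ⊕ Fin N) :
    S.Sec W →ₗ[ℝ] S.Sec W where
  toFun := c.partialDeriv hW I
  map_add' f g := by simp only [partialDeriv, map_add, Model.partialDeriv_add]
  map_smul' r f := by simp only [partialDeriv, map_smul, Model.partialDeriv_smul, RingHom.id_apply]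

theorem partialDerivₗ_apply {W : Opens S.carrier} (hW : W ≤ c.dom) (I : Fin p ⊕ Fin N)
    (f : S.Sec W) : c.partialDerivₗ hW I f = c.partialDeriv hW I f := rfl

theorem partialDeriv_mem {W : Opens S.carrier} (hW : W ≤ c.dom) (I : Fin p ⊕ Fin N) {a : Deg n}
    {f : S.Sec W} (hf : f ∈ S.grading W a) :
    c.partialDeriv hW I f ∈ S.grading W (coordDeg deg I + a) := by
  rw [← c.iso_isHomogeneous_iff hW, partialDeriv, AlgEquiv.apply_symm_apply]
  exact Model.partialDeriv_isHomogeneous I (c.iso_isHomogeneous W hW a f hf)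

theorem partialDeriv_mul {W : Opens S.carrier} (hW : W ≤ c.dom) (I : Fin p ⊕ Fin N) {a : Deg n}
    {f : S.Sec W} (hf : f ∈ S.grading W a) (g : S.Sec W) :
    c.partialDeriv hW I (f * g) =
      c.partialDeriv hW I f * g + sgn (coordDeg deg I) a • (f * c.partialDeriv hW I g) := by
  apply (c.iso W hW).injective
  simp only [partialDeriv, map_mul, map_add, map_zsmul, AlgEquiv.apply_symm_apply]
  exact Model.partialDeriv_mul I (c.iso_isHomogeneous W hW a f hf) _

theorem res_partialDeriv {W W' : Opens S.carrier} (hW : W ≤ c.dom) (h : W' ≤ W)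
    (I : Fin p ⊕ Fin N) (f : S.Sec W) :
    res h (c.partialDeriv hW I f) = c.partialDeriv (h.trans hW) I (res h f) := by
  apply (c.iso W' (h.trans hW)).injective
  rw [c.iso_res hW, partialDeriv, AlgEquiv.apply_symm_apply, partialDeriv,
    AlgEquiv.apply_symm_apply, c.iso_res hW, Model.partialDeriv_restrict]

theorem res_coord {W W' : Opens S.carrier} (hW : W ≤ c.dom) (h : W' ≤ W) (I : Fin p ⊕ Fin N) :
    res h (c.coord hW I) = c.coord (h.trans hW) I := by
  apply (c.iso W' (h.trans hW)).injective
  rw [c.iso_res hW, coord, AlgEquiv.apply_symm_apply, coord, AlgEquiv.apply_symm_apply,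
    Model.restrict_coord]

theorem coord_mem {W : Opens S.carrier} (hW : W ≤ c.dom) (I : Fin p ⊕ Fin N) :
    c.coord hW I ∈ S.grading W (coordDeg deg I) := by
  rw [← c.iso_isHomogeneous_iff hW, coord, AlgEquiv.apply_symm_apply]
  exact Model.coord_isHomogeneous I

theorem partialDeriv_coord {W : Opens S.carrier} (hW : W ≤ c.dom) (I J : Fin p ⊕ Fin N) :
    c.partialDeriv hW I (c.coord hW J) = if I = J then 1 else 0 := by
  apply (c.iso W hW).injective
  rw [coord, partialDeriv, AlgEquiv.apply_symm_apply, AlgEquiv.apply_symm_apply,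
    Model.partialDeriv_coord]
  split_ifs
  · rw [map_one]
  · rw [map_zero]

end Chart

/-! ### Derivations of the structure sheaf over an open set -/

/-- Families of linear endomorphisms of the `𝒪(U)` for `U ⊆ W` open. -/
abbrev LocalEnd (W : Opens S.carrier) : Type u :=
  (U : {U : Opens S.carrier // U ≤ W}) → (S.Sec U.1 →ₗ[ℝ] S.Sec U.1)

/-- The derivations of degree `δ` of the structure sheaf of the open subspace `W`. -/
def localDerivations (W : Opens S.carrier) (δ : Deg n) :
    Submodule ℝ (LocalEnd W) where
  carrier := {D |
    (∀ (U V : Opens S.carrier) (hU : U ≤ W) (h : V ≤ U) (f : S.Sec U),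
      res h (D ⟨U, hU⟩ f) = D ⟨V, h.trans hU⟩ (res h f)) ∧
    (∀ (U : Opens S.carrier) (hU : U ≤ W) (a : Deg n) (f : S.Sec U),
      f ∈ S.grading U a → D ⟨U, hU⟩ f ∈ S.grading U (δ + a)) ∧
    (∀ (U : Opens S.carrier) (hU : U ≤ W) (a : Deg n) (f g : S.Sec U), f ∈ S.grading U a →
      D ⟨U, hU⟩ (f * g) = D ⟨U, hU⟩ f * g + sgn δ a • (f * D ⟨U, hU⟩ g))}
  add_mem' := by
    rintro D E ⟨h1, h2, h3⟩ ⟨k1, k2, k3⟩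
    refine ⟨fun U V hU h f => ?_, fun U hU a f hf => add_mem (h2 U hU a f hf) (k2 U hU a f hf),
      fun U hU a f g hf => ?_⟩
    · simp [h1 U V hU h, k1 U V hU h]
    · simp only [Pi.add_apply, LinearMap.add_apply, h3 U hU a f g hf, k3 U hU a f g hf, add_mul,
        mul_add, smul_add]
      abel
  zero_mem' := ⟨by simp, fun U hU a f _ => zero_mem _, by simp⟩
  smul_mem' := by
    rintro r D ⟨h1, h2, h3⟩
    refine ⟨fun U V hU h f => ?_,
      fun U hU a f hf => Submodule.smul_mem _ r (h2 U hU a f hf), fun U hU a f g hf => ?_⟩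
    · simp [h1 U V hU h]
    · simp only [Pi.smul_apply, LinearMap.smul_apply, h3 U hU a f g hf, smul_add, smul_mul_assoc,
        mul_smul_comm]
      rw [smul_comm r]

section LocalDerivations

variable {W : Opens S.carrier} {δ ε : Deg n}
  {D E : LocalEnd W}

theorem localDerivations_one (hD : D ∈ localDerivations W δ) {U : Opens S.carrier} (hU : U ≤ W) :
    D ⟨U, hU⟩ 1 = 0 := by
  have h := hD.2.2 U hU 0 1 1 (one_mem U)
  rw [mul_one, mul_one, one_mul, sgn_zero_right, one_smul] at h
  exact left_eq_add.1 h

theorem localDerivations_algebraMap (hD : D ∈ localDerivations W δ) {U : Opens S.carrier}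
    (hU : U ≤ W) (r : ℝ) : D ⟨U, hU⟩ (algebraMap ℝ _ r) = 0 := by
  rw [Algebra.algebraMap_eq_smul_one, map_smul, localDerivations_one hD, smul_zero]

/-- The graded commutator of two derivations. -/
theorem commutator_mem_localDerivations (hD : D ∈ localDerivations W δ)
    (hE : E ∈ localDerivations W ε) :
    (fun U => D U ∘ₗ E U - sgn δ ε • (E U ∘ₗ D U)) ∈
      localDerivations W (δ + ε) := by
  refine ⟨fun U V hU h f => ?_, fun U hU a f hf => ?_, fun U hU a f g hf => ?_⟩
  · simp only [LinearMap.sub_apply, LinearMap.comp_apply, LinearMap.smul_apply, map_sub, map_zsmul,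
      hD.1 U V hU h, hE.1 U V hU h]
  · refine sub_mem ?_ (zsmul_mem ?_ _)
    · rw [add_assoc]
      exact hD.2.1 U hU _ _ (hE.2.1 U hU a f hf)
    · rw [add_comm δ, add_assoc]
      exact hE.2.1 U hU _ _ (hD.2.1 U hU a f hf)
  · simp only [LinearMap.sub_apply, LinearMap.comp_apply, LinearMap.smul_apply, map_add, map_zsmul,
      hE.2.2 U hU a f g hf, hD.2.2 U hU a f g hf, hD.2.2 U hU _ _ g (hE.2.1 U hU a f hf),
      hE.2.2 U hU _ _ g (hD.2.1 U hU a f hf), hD.2.2 U hU a f _ hf, hE.2.2 U hU a f _ hf,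
      sub_mul, mul_sub, smul_sub, smul_add, smul_smul, smul_mul_assoc, mul_smul_comm,
      sgn_add_left, sgn_add_right, sgn_comm ε δ]
    have h1 : sgn δ ε * (sgn δ ε * sgn ε a) = sgn ε a := by
      rw [← mul_assoc, sgn_mul_self, one_mul]
    have h2 : sgn δ a * sgn ε a * sgn δ ε = sgn δ ε * (sgn ε a * sgn δ a) := by ring
    rw [h1, h2, mul_comm (sgn ε a) (sgn δ a)]
    abel

theorem mul_left_mem_localDerivations (hD : D ∈ localDerivations W δ) {v : S.Sec W} {a : Deg n}
    (hv : v ∈ S.grading W a) (h : a + δ = ε) :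
    (fun U => LinearMap.mulLeft ℝ (res U.2 v) ∘ₗ D U) ∈ localDerivations W ε := by
  subst h
  refine ⟨fun U V hU h f => ?_, fun U hU b f hf => ?_, fun U hU b f g hf => ?_⟩
  · simp only [LinearMap.comp_apply, LinearMap.mulLeft_apply, map_mul, hD.1 U V hU h, res_res]
  · rw [add_assoc]
    exact mul_mem (res_mem hU hv) (hD.2.1 U hU b f hf)
  · simp only [LinearMap.comp_apply, LinearMap.mulLeft_apply, hD.2.2 U hU b f g hf, mul_add,
      mul_smul_comm, ← mul_assoc]
    rw [S.mul_comm_sgn U a b _ _ (res_mem hU hv) hf, smul_mul_assoc, smul_smul, sgn_add_left,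
      mul_comm (sgn a b)]

theorem restrict_mem_localDerivations (hD : D ∈ localDerivations W δ) {W' : Opens S.carrier}
    (h : W' ≤ W) : (fun U => D ⟨U.1, U.2.trans h⟩ : LocalEnd W') ∈ localDerivations W' δ :=
  ⟨fun U V hU => hD.1 U V (hU.trans h), fun U hU => hD.2.1 U (hU.trans h),
    fun U hU => hD.2.2 U (hU.trans h)⟩

variable {p N : ℕ} {deg : Fin N → Deg n} (c : S.Chart (p := p) deg)

theorem Chart.partialDerivₗ_mem_localDerivations (hW : W ≤ c.dom) (I : Fin p ⊕ Fin N) :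
    (fun U => c.partialDerivₗ (U.2.trans hW) I) ∈ localDerivations W (coordDeg deg I) :=
  ⟨fun _ _ hU h f => c.res_partialDeriv (hU.trans hW) h I f,
    fun _ hU _ _ hf => c.partialDeriv_mem (hU.trans hW) I hf,
    fun _ hU _ _ g hf => c.partialDeriv_mul (hU.trans hW) I hf g⟩

end LocalDerivations

end LocallyRingedSpace

/-! ### Derivations are determined by their values on coordinates -/

namespace Model

variable {n p N : ℕ} {deg : Fin N → Deg n} {V V' : Opens (Fin p → ℝ)}

/-- The value at `x` of the coefficient of `ξ^α`. -/
def coeffAt (α : Fin N →₀ ℕ) (x : V) : Model deg V →ₗ[ℝ] ℝ where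
  toFun f := (Series.coeff f α).1 x
  map_add' f g := by rw [Series.coeff_add]; rfl
  map_smul' r f := by rw [Series.coeff_smul]; rfl

theorem coeffAt_apply (α : Fin N →₀ ℕ) (x : V) (f : Model deg V) :
    coeffAt α x f = (Series.coeff f α).1 x := rfl

theorem coeffAt_restrict (h : V' ≤ V) (α : Fin N →₀ ℕ) (x : V') (f : Model deg V) :
    coeffAt α x (restrict h f) = coeffAt α ⟨x.1, h x.2⟩ f := by
  rw [coeffAt_apply, coeff_restrict]
  rfl

theorem eq_zero_of_coeffAt {f : Model deg V} (h : ∀ α x, coeffAt α x f = 0) : f = 0 :=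
  Series.ext_coeff fun α _ => by
    rw [Series.coeff_zero]
    exact Subtype.ext (funext fun x => h α x)

theorem coeffAt_coord_sub_mul (α : Fin N →₀ ℕ) (x : V) (a : Fin p) (g : Model deg V) :
    coeffAt α x ((coord V (Sum.inl a) - algebraMap ℝ _ (x.1 a)) * g) = 0 := by
  by_cases hα : Admissible deg α
  · have h : (coord V (Sum.inl a) - algebraMap ℝ (Model deg V) (x.1 a)) =
        Series.const (Smooth.coord V a - algebraMap ℝ _ (x.1 a)) := by
      rw [← const_algebraMap]
      exact ((constₗ (deg := deg) (V := V)).map_sub _ _).symm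
    rw [h, coeffAt_apply, Series.coeff_mul _ _ hα, Finset.sum_eq_single (0, α)]
    · rw [Series.coeff_const, if_pos rfl, Series.monoSign_zero_left, one_smul]
      change (x.1 a - x.1 a) * _ = 0
      rw [sub_self, zero_mul]
    · rintro ⟨β, γ⟩ h hne
      have : β ≠ 0 := by
        rintro rfl
        exact hne (by simpa using h)
      rw [Series.coeff_const, if_neg this, zero_mul, smul_zero]
    · simp
  · rw [coeffAt_apply, Series.coeff_eq_zero_of_not hα]
    rfl

theorem coeffAt_coord_inr_mul (α : Fin N →₀ ℕ) (x : V) (A : Fin N) (g : Model deg V)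
    (hg : ∀ β : Fin N →₀ ℕ, β.degree < α.degree → coeffAt β x g = 0) :
    coeffAt α x (coord V (Sum.inr A) * g) = 0 := by
  by_cases hα : Admissible deg α
  · rw [coeffAt_apply]
    refine (congrArg (fun s : Smooth V => s.1 x) (Series.coeff_var_mul A g hα)).trans ?_
    split_ifs with h
    · rfl
    · have hle : Finsupp.single A 1 ≤ α := Finsupp.single_le_iff.2 (Nat.one_le_iff_ne_zero.2 h)
      have h1 := hg (α - Finsupp.single A 1) (by
        conv_rhs => rw [← tsub_add_cancel_of_le hle]
        rw [map_add, Finsupp.degree_single]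
        exact Nat.lt_succ_self _)
      rw [coeffAt_apply] at h1
      change (_ • _ : V → ℝ) x = 0
      rw [Pi.smul_apply, h1, smul_zero]
  · rw [coeffAt_apply, Series.coeff_eq_zero_of_not hα]
    rfl

end Model

namespace LocallyRingedSpace

variable {n : ℕ} {S : LocallyRingedSpace.{u} n} {p N : ℕ} {deg : Fin N → Deg n}
  (c : S.Chart (p := p) deg) {W : Opens S.carrier} {δ : Deg n} {D : LocalEnd W}

/-- A derivation of the structure sheaf that kills the coordinates vanishes. By Hadamard's lemma,
it sends a function, near any point `x`, to a combination of the functions `x^a - x^a(x)` and `ξ^A`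
with coefficients of the same kind; so the coefficient of `ξ^α` of the result vanishes at `x` by
induction on the order of `α`. -/
theorem localDerivations_eq_zero_of_coord (hW : W ≤ c.dom) (hD : D ∈ localDerivations W δ)
    (h : ∀ I, D ⟨W, le_rfl⟩ (c.coord hW I) = 0) (U : {U : Opens S.carrier // U ≤ W}) :
    D U = 0 := by
  have hcoord : ∀ (U : Opens S.carrier) (hU : U ≤ W) (I : Fin p ⊕ Fin N),
      D ⟨U, hU⟩ (c.coord (hU.trans hW) I) = 0 := fun U hU I => by
    rw [← c.res_coord hW hU, ← hD.1 W U le_rfl hU, h, map_zero]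
  have key : ∀ (m : ℕ) (U : Opens S.carrier) (hU : U ≤ W) (f : S.Sec U) (α : Fin N →₀ ℕ),
      α.degree = m → ∀ x : imageOpens c.homeo U,
        Model.coeffAt α x (c.iso U (hU.trans hW) (D ⟨U, hU⟩ f)) = 0 := by
    intro m
    induction m using Nat.strong_induction_on with
    | _ m ih =>
      intro U hU f α hα x
      obtain ⟨r, hr, H⟩ := Model.exists_restrict_eq (c.iso U (hU.trans hW) f) x
      -- the part of `U` over the ball around `x`
      let U' : Opens S.carrier :=
        ⟨c.homeo.source ∩ c.homeo ⁻¹' Metric.ball x.1 r,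
          c.homeo.isOpen_inter_preimage Metric.isOpen_ball⟩ ⊓ U
      have hU' : U' ≤ U := inf_le_right
      have hball : (imageOpens c.homeo U' : Set (Fin p → ℝ)) ⊆ Metric.ball x.1 r := by
        rintro y ⟨hy, hy'⟩
        have h1 : c.homeo (c.homeo.symm y) ∈ Metric.ball x.1 r := hy'.1.2
        rwa [c.homeo.right_inv hy] at h1
      have hx : x.1 ∈ imageOpens c.homeo U' := by
        refine ⟨x.2.1, ⟨c.homeo.map_target x.2.1, ?_⟩, x.2.2⟩
        change c.homeo (c.homeo.symm x.1) ∈ Metric.ball x.1 r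
        rw [c.homeo.right_inv x.2.1]
        exact Metric.mem_ball_self hr
      obtain ⟨t, g, hg⟩ := H _ (imageOpens_mono c.homeo hU') hball
      have hdom : U' ≤ c.dom := hU'.trans (hU.trans hW)
      let G : Fin p ⊕ Fin N → S.Sec U' := fun I => (c.iso U' hdom).symm (g I)
      have hf : res hU' f = algebraMap ℝ _ t +
          (∑ a, (c.coord hdom (Sum.inl a) - algebraMap ℝ _ (x.1 a)) * G (Sum.inl a) +
            ∑ A, c.coord hdom (Sum.inr A) * G (Sum.inr A)) := by
        apply (c.iso U' hdom).injective
        rw [c.iso_res (hU.trans hW) hU' f, hg]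
        simp only [map_add, map_sum, map_mul, map_sub, G, Chart.coord, AlgEquiv.apply_symm_apply,
          AlgEquiv.commutes]
      have hDf : D ⟨U', hU'.trans hU⟩ (res hU' f) =
          ∑ a, (c.coord hdom (Sum.inl a) - algebraMap ℝ _ (x.1 a)) *
              D ⟨U', hU'.trans hU⟩ (G (Sum.inl a)) +
            ∑ A, sgn δ (deg A) • (c.coord hdom (Sum.inr A) *
              D ⟨U', hU'.trans hU⟩ (G (Sum.inr A))) := by
        rw [hf, map_add, map_add, localDerivations_algebraMap hD, zero_add, map_sum, map_sum]
        refine congrArg₂ _ (Finset.sum_congr rfl fun a _ => ?_) (Finset.sum_congr rfl fun A _ => ?_)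
        · rw [hD.2.2 U' (hU'.trans hU) 0 _ _ (sub_mem (c.coord_mem hdom (Sum.inl a))
            (algebraMap_mem U' _)), map_sub, hcoord, localDerivations_algebraMap hD, sub_zero,
            zero_mul, zero_add, sgn_zero_right, one_smul]
        · rw [hD.2.2 U' (hU'.trans hU) (deg A) _ _ (c.coord_mem hdom (Sum.inr A)), hcoord,
            zero_mul, zero_add]
      have h1 := Model.coeffAt_restrict (imageOpens_mono c.homeo hU') α ⟨x.1, hx⟩
        (c.iso U (hU.trans hW) (D ⟨U, hU⟩ f))
      rw [← c.iso_res (hU.trans hW) hU', hD.1 U U' hU hU', hDf] at h1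
      refine h1.symm.trans ?_
      simp only [map_add, map_sum, map_mul, map_sub, map_zsmul, Chart.coord,
        AlgEquiv.apply_symm_apply, AlgEquiv.commutes]
      rw [Finset.sum_eq_zero fun a _ => Model.coeffAt_coord_sub_mul α ⟨x.1, hx⟩ a _, zero_add]
      refine Finset.sum_eq_zero fun A _ => ?_
      rw [Model.coeffAt_coord_inr_mul α ⟨x.1, hx⟩ A _ fun β hβ =>
        ih β.degree (hα ▸ hβ) U' (hU'.trans hU) (G (Sum.inr A)) β rfl _, smul_zero]
  refine LinearMap.ext fun f => (c.iso U.1 (U.2.trans hW)).injective ?_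
  rw [LinearMap.zero_apply, map_zero]
  exact Model.eq_zero_of_coeffAt fun α x => key _ U.1 U.2 f α rfl x

/-- The derivation `∑ v^I ∂/∂x^I`. -/
def Chart.vectorField (hW : W ≤ c.dom) (v : Fin p ⊕ Fin N → S.Sec W) : LocalEnd W :=
  ∑ I, fun U => LinearMap.mulLeft ℝ (res U.2 (v I)) ∘ₗ c.partialDerivₗ (U.2.trans hW) I

theorem Chart.vectorField_apply (hW : W ≤ c.dom) (v : Fin p ⊕ Fin N → S.Sec W)
    (U : {U : Opens S.carrier // U ≤ W}) (f : S.Sec U.1) :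
    c.vectorField hW v U f = ∑ I, res U.2 (v I) * c.partialDeriv (U.2.trans hW) I f := by
  simp only [Chart.vectorField, Finset.sum_apply, LinearMap.sum_apply]
  rfl

theorem Chart.vectorField_mem (hW : W ≤ c.dom) {v : Fin p ⊕ Fin N → S.Sec W}
    (hv : ∀ I, v I ∈ S.grading W (δ + coordDeg deg I)) :
    c.vectorField hW v ∈ localDerivations W δ :=
  Submodule.sum_mem _ fun I _ => mul_left_mem_localDerivations
    (c.partialDerivₗ_mem_localDerivations hW I) (hv I) (deg_add_add_self _ _)

theorem Chart.vectorField_coord (hW : W ≤ c.dom) (v : Fin p ⊕ Fin N → S.Sec W)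
    (I : Fin p ⊕ Fin N) : c.vectorField hW v ⟨W, le_rfl⟩ (c.coord hW I) = v I := by
  rw [vectorField_apply, Finset.sum_eq_single I]
  · rw [partialDeriv_coord, if_pos rfl, mul_one, res_self]
  · intro J _ hJ
    rw [partialDeriv_coord, if_neg hJ, mul_zero]
  · simp

/-- Every derivation of the structure sheaf is of the form `∑ D(x^I) ∂/∂x^I` in a chart. -/
theorem localDerivations_eq_vectorField (hW : W ≤ c.dom) (hD : D ∈ localDerivations W δ) :
    D = c.vectorField hW fun I => D ⟨W, le_rfl⟩ (c.coord hW I) := by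
  have hE := c.vectorField_mem (v := fun I => D ⟨W, le_rfl⟩ (c.coord hW I)) hW fun I =>
    hD.2.1 W le_rfl _ _ (c.coord_mem hW I)
  refine funext fun U => sub_eq_zero.1 ?_
  exact localDerivations_eq_zero_of_coord c hW (sub_mem hD hE) (fun I => by
    rw [Pi.sub_apply, LinearMap.sub_apply, Chart.vectorField_coord, sub_self]) U

theorem localDerivations_apply (hW : W ≤ c.dom) (hD : D ∈ localDerivations W δ)
    (U : {U : Opens S.carrier // U ≤ W}) (f : S.Sec U.1) :
    D U f = ∑ I, res U.2 (D ⟨W, le_rfl⟩ (c.coord hW I)) * c.partialDeriv (U.2.trans hW) I f := by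
  conv_lhs => rw [localDerivations_eq_vectorField c hW hD, Chart.vectorField_apply]

/-- The partial derivatives commute in the graded sense. -/
theorem Chart.partialDeriv_comm (hW : W ≤ c.dom) (I J : Fin p ⊕ Fin N) (f : S.Sec W) :
    c.partialDeriv hW I (c.partialDeriv hW J f) =
      sgn (coordDeg deg I) (coordDeg deg J) •
        c.partialDeriv hW J (c.partialDeriv hW I f) := by
  have h := localDerivations_eq_zero_of_coord c hW (commutator_mem_localDerivations
    (c.partialDerivₗ_mem_localDerivations hW I) (c.partialDerivₗ_mem_localDerivations hW J))
    (fun K => by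
      have h0 : ∀ (L : Fin p ⊕ Fin N) (P : Prop) [Decidable P],
          c.partialDeriv hW L (if P then 1 else 0) = 0 := fun L P _ => by
        split_ifs
        · exact localDerivations_one (c.partialDerivₗ_mem_localDerivations hW L) le_rfl
        · exact map_zero (c.partialDerivₗ hW L)
      simp only [LinearMap.sub_apply, LinearMap.smul_apply, LinearMap.comp_apply,
        partialDerivₗ_apply, partialDeriv_coord, h0, smul_zero, sub_self]) ⟨W, le_rfl⟩
  exact sub_eq_zero.1 (DFunLike.congr_fun h f)

/-- The chain rule. -/
theorem Chart.partialDeriv_eq_sum (c' : S.Chart (p := p) deg) (hW : W ≤ c.dom) (hW' : W ≤ c'.dom)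
    (I : Fin p ⊕ Fin N) (f : S.Sec W) :
    c.partialDeriv hW I f =
      ∑ J, c.partialDeriv hW I (c'.coord hW' J) * c'.partialDeriv hW' J f := by
  have h := localDerivations_apply c' hW' (c.partialDerivₗ_mem_localDerivations hW I) ⟨W, le_rfl⟩ f
  simpa only [res_self, partialDerivₗ_apply] using h

end LocallyRingedSpace

/-! ### Gluing over the charts of a manifold -/

namespace Manifold

open LocallyRingedSpace

variable {n : ℕ} {M : Manifold.{u} n}

theorem le_iSup_inf_dom (U : Opens M.carrier) : U ≤ ⨆ c : M.Chart, U ⊓ c.dom := by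
  intro x hx
  obtain ⟨c, hc⟩ := M.exists_chart x
  exact Opens.mem_iSup.2 ⟨c, hx, hc⟩

theorem existsUnique_glue {U : Opens M.carrier} (s : (c : M.Chart) → M.Sec (U ⊓ c.dom))
    (hs : ∀ (c c' : M.Chart) (W : Opens M.carrier) (h : W ≤ U ⊓ c.dom) (h' : W ≤ U ⊓ c'.dom),
      res h (s c) = res h' (s c')) :
    ∃! t : M.Sec U, ∀ c : M.Chart, res inf_le_left t = s c :=
  TopCat.Sheaf.existsUnique_gluing' ⟨M.presheaf, M.isSheaf⟩ (fun c : M.Chart => U ⊓ c.dom) U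
    (fun _ => homOfLE inf_le_left) (le_iSup_inf_dom U) s
    (fun c c' => hs c c' _ inf_le_left inf_le_right)

theorem eq_of_res_eq {U : Opens M.carrier} {s t : M.Sec U}
    (h : ∀ c : M.Chart, res (inf_le_left : U ⊓ c.dom ≤ U) s = res inf_le_left t) : s = t :=
  (existsUnique_glue (fun c => res (inf_le_left : U ⊓ c.dom ≤ U) t)
    (fun c c' W h h' => by rw [res_res, res_res])).unique h fun _ => rfl

theorem mem_grading_of_res {U : Opens M.carrier} {a : Deg n} {s : M.Sec U}
    (h : ∀ c : M.Chart, res (inf_le_left : U ⊓ c.dom ≤ U) s ∈ M.grading _ a) :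
    s ∈ M.grading U a :=
  mem_of_proj_eq (eq_of_res_eq fun c => by rw [res_proj, proj_of_mem (h c), if_pos rfl])

/-- Derivations over the chart domains that agree on overlaps glue. -/
theorem exists_derivation_of_charts {δ : Deg n} (X : (c : M.Chart) → LocalEnd c.dom)
    (hX : ∀ c, X c ∈ localDerivations c.dom δ)
    (hcompat : ∀ (c c' : M.Chart) (W : Opens M.carrier) (h : W ≤ c.dom) (h' : W ≤ c'.dom),
      X c ⟨W, h⟩ = X c' ⟨W, h'⟩) :
    ∃ D ∈ M.derivations δ, ∀ (c : M.Chart) (W : Opens M.carrier) (h : W ≤ c.dom),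
      D W = X c ⟨W, h⟩ := by
  have hex : ∀ (U : Opens M.carrier) (f : M.Sec U), ∃ t : M.Sec U, ∀ c : M.Chart,
      res inf_le_left t = X c ⟨U ⊓ c.dom, inf_le_right⟩ (res inf_le_left f) := fun U f =>
    (existsUnique_glue (fun c => X c ⟨U ⊓ c.dom, inf_le_right⟩ (res inf_le_left f))
      (fun c c' W h h' => by
        rw [(hX c).1 _ W inf_le_right h, (hX c').1 _ W inf_le_right h', res_res, res_res,
          hcompat c c' W _ (h'.trans inf_le_right)])).exists
  choose d hd using hex
  let D : (U : Opens M.carrier) → (M.Sec U →ₗ[ℝ] M.Sec U) := fun U =>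
    { toFun := d U
      map_add' := fun f g => eq_of_res_eq fun c => by
        rw [hd, map_add, map_add, map_add, hd, hd]
      map_smul' := fun r f => eq_of_res_eq fun c => by
        rw [hd, map_smul, map_smul, RingHom.id_apply, map_smul, hd] }
  have hD : ∀ (U : Opens M.carrier) (f : M.Sec U) (c : M.Chart),
      res inf_le_left (D U f) = X c ⟨U ⊓ c.dom, inf_le_right⟩ (res inf_le_left f) := hd
  refine ⟨D, ⟨fun U V h f => eq_of_res_eq fun c => ?_,
    fun U a f hf => mem_grading_of_res fun c => ?_,
    fun U a f g hf => eq_of_res_eq fun c => ?_⟩, fun c W h => LinearMap.ext fun f => ?_⟩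
  · have h1 : V ⊓ c.dom ≤ U ⊓ c.dom := inf_le_inf_right _ h
    rw [hD, res_res, res_res, ← res_res (inf_le_left : U ⊓ c.dom ≤ U) h1, hD,
      (hX c).1 _ _ inf_le_right h1, res_res]
  · rw [hD]
    exact (hX c).2.1 _ _ a _ (res_mem _ hf)
  · rw [hD, map_mul, (hX c).2.2 _ _ a _ _ (res_mem _ hf), map_add, map_zsmul, map_mul, map_mul,
      hD, hD]
  · refine res_injective (inf_le_left : W ⊓ c.dom ≤ W) (le_inf le_rfl h) ?_
    rw [hD, (hX c).1 W _ h inf_le_left]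

theorem derivations_mem_localDerivations {δ : Deg n}
    {D : (U : Opens M.carrier) → (M.Sec U →ₗ[ℝ] M.Sec U)} (hD : D ∈ M.derivations δ)
    (W : Opens M.carrier) : (fun U => D U.1 : LocalEnd W) ∈ localDerivations W δ :=
  ⟨fun U V _ h => hD.1 U V h, fun U _ => hD.2.1 U, fun U _ => hD.2.2 U⟩

theorem Vect.res_apply (X : M.Vect) {U V : Opens M.carrier} (h : V ≤ U) (f : M.Sec U) :
    res h (X.1 U f) = X.1 V (res h f) := by
  refine Submodule.iSup_induction M.derivations (motive := fun X => res h (X U f) = X V (res h f))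
    X.2 (fun δ D hD => hD.1 U V h f) ?_ fun D E hD hE => ?_
  · simp
  · simp [hD, hE]

/-- A vector field is determined in a chart by its components `X(x^I)`. -/
theorem Vect.apply_eq_sum (X : M.Vect) (c : M.Chart) {W : Opens M.carrier} (hW : W ≤ c.dom)
    (f : M.Sec W) :
    X.1 W f = ∑ I, X.1 W (c.coord hW I) * c.partialDeriv hW I f := by
  refine Submodule.iSup_induction M.derivations
    (motive := fun X => X W f = ∑ I, X W (c.coord hW I) * c.partialDeriv hW I f)
    X.2 (fun δ D hD => ?_) ?_ fun D E hD hE => ?_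
  · have h := localDerivations_apply c hW (derivations_mem_localDerivations hD W) ⟨W, le_rfl⟩ f
    simpa only [res_self] using h
  · simp
  · simp only [Pi.add_apply, LinearMap.add_apply, hD, hE, add_mul, Finset.sum_add_distrib]

theorem Vect.ext_of_coord {X Y : M.Vect}
    (h : ∀ (c : M.Chart) (I : M.Idx), X.1 c.dom (c.coord le_rfl I) = Y.1 c.dom (c.coord le_rfl I)) :
    X = Y := by
  refine Subtype.ext (funext fun U => LinearMap.ext fun f => eq_of_res_eq fun c => ?_)
  rw [res_apply, res_apply, apply_eq_sum X c inf_le_right, apply_eq_sum Y c inf_le_right]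
  refine Finset.sum_congr rfl fun I _ => ?_
  rw [← c.res_coord le_rfl inf_le_right, ← res_apply, ← res_apply, h]

/-! ### The equation `i_X ω = df` -/

theorem deRham_zeroForm (f : M.Fn) (c : M.Chart) (w : Fin 1 → M.Idx) :
    deRham (zeroForm f) c w = c.partialDeriv le_rfl (w 0) (res le_top f) := by
  have h : Finset.Iio (0 : Fin 1) = ∅ := by decide
  simp [deRham, zeroForm, wordDeg, sgn_zero_right, h]

theorem contract_two (X : M.Vect) (ω : M.LocalForms 2) (c : M.Chart) (w : Fin 1 → M.Idx) :
    contract X ω c w = ∑ I, twist (M.idxDeg (w 0)) (X.1 c.dom (c.coord le_rfl I)) *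
      ω c ![I, w 0] := by
  have h : M.wordDeg w = M.idxDeg (w 0) := by simp [wordDeg]
  rw [contract, h]
  refine Finset.sum_congr rfl fun I _ => ?_
  congr 2
  funext i
  refine Fin.cases rfl (fun j => ?_) i
  rw [Subsingleton.elim j 0]
  rfl

theorem contract_eq_deRham_iff {X : M.Vect} {ω : M.LocalForms 2} {f : M.Fn} :
    contract X ω = deRham (zeroForm f) ↔ ∀ (c : M.Chart) (J : M.Idx),
      ∑ I, twist (M.idxDeg J) (X.1 c.dom (c.coord le_rfl I)) * ω c ![I, J] =
        c.partialDeriv le_rfl J (res le_top f) := by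
  refine ⟨fun h c J => ?_, fun h => funext fun c => funext fun w => ?_⟩
  · have := congrFun (congrFun h c) ![J]
    rwa [contract_two, deRham_zeroForm] at this
  · rw [contract_two, deRham_zeroForm, h]

theorem IsOfDegree.two_mem {ω : M.LocalForms 2} {γ : Deg n} (h : IsOfDegree ω γ) (c : M.Chart)
    (I J : M.Idx) : ω c ![I, J] ∈ M.grading c.dom (γ + (M.idxDeg I + M.idxDeg J)) := by
  simpa [wordDeg, Fin.sum_univ_two] using h c ![I, J]

variable {ω : M.LocalForms 2} {γ : Deg n}

/-- The components of `i_X ω` are obtained from twisted components of `X` by applying the matrix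
of `ω`. -/
theorem sum_twist_mul_eq_mulVec (hω : IsOfDegree ω γ) (c : M.Chart) {W : Opens M.carrier}
    (hW : W ≤ c.dom) (x : M.Idx → M.Sec W) (J : M.Idx) :
    ∑ I, twist (M.idxDeg J) (x I) * res hW (ω c ![I, J]) =
      (((Matrix.of fun J I : M.Idx => ω c ![I, J]).map (res hW)).mulVec
        fun I => twist (γ + M.idxDeg I) (x I)) J := by
  refine Finset.sum_congr rfl fun I _ => ?_
  refine twist_mul_eq_mul_twist (res_mem hW (hω.two_mem c I J)) ?_ _
  rw [add_comm (M.idxDeg J), ← add_assoc γ, deg_add_add_self]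

theorem IsNondegenerate.exists_inverse (hω : IsNondegenerate ω) (c : M.Chart) {W : Opens M.carrier}
    (hW : W ≤ c.dom) : ∃ Θ : Matrix M.Idx M.Idx (M.Sec W),
      (Matrix.of fun J I : M.Idx => ω c ![I, J]).map (res hW) * Θ = 1 ∧
        Θ * (Matrix.of fun J I : M.Idx => ω c ![I, J]).map (res hW) = 1 := by
  obtain ⟨u, hu⟩ := (hω c).map (res hW).toRingHom.mapMatrix
  have h : (Matrix.of fun J I : M.Idx => ω c ![I, J]).map (res hW) = u.1 := hu.symm
  exact ⟨u⁻¹.1, by rw [h]; exact u.mul_inv, by rw [h]; exact u.inv_mul⟩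

/-- The components of `i_X ω` over `W` determine the components of `X`. -/
theorem IsSymplectic.eq_of_sum_twist_mul_eq (hω : IsSymplectic ω γ) (c : M.Chart)
    {W : Opens M.carrier} (hW : W ≤ c.dom) {x y : M.Idx → M.Sec W}
    (h : ∀ J, ∑ I, twist (M.idxDeg J) (x I) * res hW (ω c ![I, J]) =
      ∑ I, twist (M.idxDeg J) (y I) * res hW (ω c ![I, J])) : x = y := by
  obtain ⟨Θ, -, hΘ⟩ := hω.isNondegenerate.exists_inverse c hW
  simp only [sum_twist_mul_eq_mulVec hω.isOfDegree] at h
  have h1 := congrArg Θ.mulVec (funext h)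
  rw [Matrix.mulVec_mulVec, Matrix.mulVec_mulVec, hΘ, Matrix.one_mulVec, Matrix.one_mulVec] at h1
  refine funext fun I => ?_
  rw [← twist_twist (γ + M.idxDeg I) (x I), congrFun h1 I, twist_twist]

/-- The solution of the linear system for the components of `X` with a homogeneous right-hand side
can be taken homogeneous, by projecting any solution to the expected degree. -/
theorem IsSymplectic.exists_homogeneous_solution (hω : IsSymplectic ω γ) (c : M.Chart) {a : Deg n}
    {b : M.Idx → M.Sec c.dom} (hb : ∀ J, b J ∈ M.grading c.dom (M.idxDeg J + a)) :
    ∃ x : M.Idx → M.Sec c.dom, (∀ I, x I ∈ M.grading c.dom (a + γ + M.idxDeg I)) ∧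
      ∀ J, ∑ I, twist (M.idxDeg J) (x I) * ω c ![I, J] = b J := by
  obtain ⟨Θ, hΘ, -⟩ := hω.isNondegenerate.exists_inverse c le_rfl
  set y := Θ.mulVec b with hy
  have hyb : ((Matrix.of fun J I : M.Idx => ω c ![I, J]).map (res le_rfl)).mulVec y = b := by
    rw [hy, Matrix.mulVec_mulVec, hΘ, Matrix.one_mulVec]
  refine ⟨fun I => twist (γ + M.idxDeg I)
    (GradedRing.proj (M.grading c.dom) (a + γ + M.idxDeg I) (y I)),
    fun I => twist_mem _ (proj_mem _ _), fun J => ?_⟩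
  have h := sum_twist_mul_eq_mulVec hω.isOfDegree c le_rfl (fun I => twist (γ + M.idxDeg I)
    (GradedRing.proj (M.grading c.dom) (a + γ + M.idxDeg I) (y I))) J
  simp only [res_self, twist_twist] at h
  rw [h, ← (proj_of_mem (hb J) (M.idxDeg J + a)).trans (if_pos rfl), ← hyb, Matrix.mulVec,
    Matrix.mulVec, dotProduct, dotProduct, map_sum]
  refine Finset.sum_congr rfl fun I _ => ?_
  have hI : (Matrix.of fun J I : M.Idx => ω c ![I, J]).map (res le_rfl) J I ∈
      M.grading c.dom (γ + (M.idxDeg I + M.idxDeg J)) := res_mem _ (hω.isOfDegree.two_mem c I J)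
  rw [← proj_mul_of_mem_left hI]
  congr 2
  have h2 : γ + (M.idxDeg I + M.idxDeg J) + (a + γ + M.idxDeg I) =
      M.idxDeg J + a + (γ + γ) + (M.idxDeg I + M.idxDeg I) := by abel
  rw [h2, deg_add_self, deg_add_self, add_zero, add_zero]

theorem IsForm.two_transform (hω : IsForm ω) (c c' : M.Chart) {W : Opens M.carrier}
    (hW : W ≤ c.dom) (hW' : W ≤ c'.dom) (I J : M.Idx) :
    res hW (ω c ![I, J]) = ∑ I', ∑ J',
      twist (M.idxDeg J) (c.partialDeriv hW I (c'.coord hW' I')) *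
        (c.partialDeriv hW J (c'.coord hW' J') * res hW' (ω c' ![I', J'])) := by
  have h := congrArg (res (le_inf hW hW')) (hω.transform c c' ![I, J])
  rw [res_res, ← (finTwoArrowEquiv M.Idx).symm.sum_comp, Fintype.sum_prod_type, map_sum] at h
  rw [h]
  refine Finset.sum_congr rfl fun I' _ => ?_
  rw [map_sum]
  refine Finset.sum_congr rfl fun J' _ => ?_
  rw [map_mul, res_res]
  have h1 : M.wordDeg (Fin.tail ![I, J]) = M.idxDeg J := by simp [wordDeg, Fin.tail]
  have h2 : M.wordDeg (Fin.tail (Fin.tail ![I, J])) = 0 := by simp [wordDeg]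
  rw [jacobian, jacobian, jacobian, h1, h2, twist_zero_deg, mul_one, map_mul, res_twist,
    c.res_partialDeriv inf_le_left, c.res_partialDeriv inf_le_left, c'.res_coord inf_le_right,
    c'.res_coord inf_le_right, mul_assoc]
  rfl

/-- A solution of `i_X ω = df` in one chart is a solution in any other chart. -/
theorem IsForm.solution_transform (hω : IsForm ω) (c c' : M.Chart) {W : Opens M.carrier}
    (hW : W ≤ c.dom) (hW' : W ≤ c'.dom) {δ : Deg n} {D : LocalEnd W}
    (hD : D ∈ localDerivations W δ) {f : M.Sec W}
    (h : ∀ J, ∑ I, twist (M.idxDeg J) (D ⟨W, le_rfl⟩ (c'.coord hW' I)) * res hW' (ω c' ![I, J]) =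
      c'.partialDeriv hW' J f) (J : M.Idx) :
    ∑ I, twist (M.idxDeg J) (D ⟨W, le_rfl⟩ (c.coord hW I)) * res hW (ω c ![I, J]) =
      c.partialDeriv hW J f := by
  have hd : ∀ I', D ⟨W, le_rfl⟩ (c'.coord hW' I') = ∑ I, D ⟨W, le_rfl⟩ (c.coord hW I) *
      c.partialDeriv hW I (c'.coord hW' I') := fun I' => by
    have := localDerivations_apply c hW hD ⟨W, le_rfl⟩ (c'.coord hW' I')
    simpa only [res_self] using this
  have hmove : ∀ I' J', twist (M.idxDeg J) (D ⟨W, le_rfl⟩ (c'.coord hW' I')) *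
      c.partialDeriv hW J (c'.coord hW' J') = c.partialDeriv hW J (c'.coord hW' J') *
        twist (M.idxDeg J') (D ⟨W, le_rfl⟩ (c'.coord hW' I')) := fun I' J' =>
    twist_mul_eq_mul_twist (c.partialDeriv_mem hW J (c'.coord_mem hW' J'))
      (by rw [← add_assoc, deg_add_self, zero_add]) _
  calc ∑ I, twist (M.idxDeg J) (D ⟨W, le_rfl⟩ (c.coord hW I)) * res hW (ω c ![I, J])
      = ∑ I, ∑ I', ∑ J', twist (M.idxDeg J) (D ⟨W, le_rfl⟩ (c.coord hW I) *
          c.partialDeriv hW I (c'.coord hW' I')) *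
            (c.partialDeriv hW J (c'.coord hW' J') * res hW' (ω c' ![I', J'])) := by
        refine Finset.sum_congr rfl fun I _ => ?_
        rw [hω.two_transform c c' hW hW', Finset.mul_sum]
        refine Finset.sum_congr rfl fun I' _ => ?_
        rw [Finset.mul_sum]
        refine Finset.sum_congr rfl fun J' _ => ?_
        rw [twist_mul, mul_assoc]
    _ = ∑ I', ∑ J', twist (M.idxDeg J) (D ⟨W, le_rfl⟩ (c'.coord hW' I')) *
            (c.partialDeriv hW J (c'.coord hW' J') * res hW' (ω c' ![I', J'])) := by
        rw [Finset.sum_comm]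
        refine Finset.sum_congr rfl fun I' _ => ?_
        rw [Finset.sum_comm]
        refine Finset.sum_congr rfl fun J' _ => ?_
        rw [hd, twist_sum, Finset.sum_mul]
    _ = ∑ J', c.partialDeriv hW J (c'.coord hW' J') * c'.partialDeriv hW' J' f := by
        rw [Finset.sum_comm]
        refine Finset.sum_congr rfl fun J' _ => ?_
        rw [← h J', Finset.mul_sum]
        refine Finset.sum_congr rfl fun I' _ => ?_
        rw [← mul_assoc, hmove, mul_assoc]
    _ = c.partialDeriv hW J f := (c.partialDeriv_eq_sum c' hW hW' J f).symm

/-- Homogeneous functions have Hamiltonian vector fields: the solutions over the charts agree on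
overlaps by uniqueness. -/
theorem IsSymplectic.exists_derivation (hω : IsSymplectic ω γ) {a : Deg n} {f : M.Fn}
    (hf : f ∈ M.grading ⊤ a) : ∃ X : M.Vect, X.1 ∈ M.derivations (a + γ) ∧
      contract X ω = deRham (zeroForm f) := by
  have hsol := fun c : M.Chart => hω.exists_homogeneous_solution c
    (b := fun J => c.partialDeriv le_rfl J (res le_top f))
    fun J => c.partialDeriv_mem le_rfl J (res_mem le_top hf)
  choose x hx hxb using hsol
  have hX : ∀ c : M.Chart, c.vectorField le_rfl (x c) ∈ localDerivations c.dom (a + γ) :=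
    fun c => c.vectorField_mem le_rfl (hx c)
  have hcoord : ∀ (c : M.Chart) (W : Opens M.carrier) (hW : W ≤ c.dom) (I : M.Idx),
      c.vectorField le_rfl (x c) ⟨W, hW⟩ (c.coord hW I) = res hW (x c I) := fun c W hW I => by
    rw [← c.res_coord le_rfl hW, ← (hX c).1 c.dom W le_rfl hW, Chart.vectorField_coord]
  have hres : ∀ (c : M.Chart) (W : Opens M.carrier) (hW : W ≤ c.dom) (J : M.Idx),
      ∑ I, twist (M.idxDeg J) (res hW (x c I)) * res hW (ω c ![I, J]) =
        c.partialDeriv hW J (res le_top f) := fun c W hW J => by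
    rw [← res_res le_top hW, ← c.res_partialDeriv le_rfl hW, ← hxb c J, map_sum]
    exact Finset.sum_congr rfl fun I _ => by rw [map_mul, res_twist]
  obtain ⟨D, hD, hDX⟩ := exists_derivation_of_charts (fun c => c.vectorField le_rfl (x c)) hX
    fun c c' W hW hW' => by
      have hr := restrict_mem_localDerivations (hX c') hW'
      have h1 := hω.isForm.solution_transform c c' hW hW' hr (f := res le_top f) fun J => by
        simp only [hcoord c' W hW']
        exact hres c' W hW' J
      have h2 := hω.eq_of_sum_twist_mul_eq c hW fun J => (hres c W hW J).trans (h1 J).symm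
      refine LinearMap.ext fun g => ?_
      have h3 := localDerivations_apply c hW hr ⟨W, le_rfl⟩ g
      simp only [res_self] at h3
      refine Eq.trans ?_ h3.symm
      rw [Chart.vectorField_apply]
      exact Finset.sum_congr rfl fun I _ => by rw [← congrFun h2 I]
  refine ⟨⟨D, Submodule.mem_iSup_of_mem _ hD⟩, hD, contract_eq_deRham_iff.2 fun c J => ?_⟩
  rw [← hxb c J]
  refine Finset.sum_congr rfl fun I _ => ?_
  change twist _ (D c.dom _) * _ = _
  rw [hDX c c.dom le_rfl, Chart.vectorField_coord]

theorem IsSymplectic.contract_injective (hω : IsSymplectic ω γ) {X Y : M.Vect}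
    (h : contract X ω = contract Y ω) : X = Y := by
  refine Vect.ext_of_coord fun c => congrFun ?_
  refine hω.eq_of_sum_twist_mul_eq c le_rfl fun J => ?_
  have := congrFun (congrFun h c) ![J]
  rw [contract_two, contract_two] at this
  simp only [res_self]
  exact this

theorem IsSymplectic.existsUnique_contract (hω : IsSymplectic ω γ) (f : M.Fn) :
    ∃! X : M.Vect, contract X ω = deRham (zeroForm f) := by
  have hex : ∀ a : Deg n, ∃ X : M.Vect,
      contract X ω = deRham (zeroForm (GradedRing.proj (M.grading ⊤) a f)) := fun a =>
    (hω.exists_derivation (proj_mem a f)).imp fun _ h => h.2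
  choose X hX using hex
  have hsum : contract (∑ a, X a) ω = deRham (zeroForm f) := by
    refine contract_eq_deRham_iff.2 fun c J => ?_
    have h : ∀ I, (∑ a, X a).1 c.dom (c.coord le_rfl I) =
        ∑ a, (X a).1 c.dom (c.coord le_rfl I) := fun I => by
      simp [Finset.sum_apply]
    simp only [h, twist_sum, Finset.sum_mul]
    rw [Finset.sum_comm]
    simp only [fun a => contract_eq_deRham_iff.1 (hX a) c J]
    rw [← Chart.partialDerivₗ_apply, ← sum_proj f, map_sum, map_sum]
    simp only [sum_proj]
    rfl
  exact ⟨∑ a, X a, hsum, fun Y hY => hω.contract_injective (hY.trans hsum.symm)⟩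

theorem IsSymplectic.contract_hamiltonian (hω : IsSymplectic ω γ) (f : M.Fn) :
    contract (hamiltonian ω f) ω = deRham (zeroForm f) := by
  have h := (hω.existsUnique_contract f).exists
  rw [hamiltonian, dif_pos h]
  exact h.choose_spec

theorem IsSymplectic.eq_hamiltonian (hω : IsSymplectic ω γ) {X : M.Vect} {f : M.Fn}
    (h : contract X ω = deRham (zeroForm f)) : X = hamiltonian ω f :=
  hω.contract_injective (h.trans (hω.contract_hamiltonian f).symm)

theorem IsSymplectic.hamiltonian_mem (hω : IsSymplectic ω γ) {a : Deg n} {f : M.Fn}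
    (hf : f ∈ M.grading ⊤ a) : (hamiltonian ω f).1 ∈ M.derivations (a + γ) := by
  obtain ⟨X, hX, h⟩ := hω.exists_derivation hf
  rwa [← hω.eq_hamiltonian h]

theorem IsSymplectic.poisson_mem (hω : IsSymplectic ω γ) {a b : Deg n} {f g : M.Fn}
    (hf : f ∈ M.grading ⊤ a) (hg : g ∈ M.grading ⊤ b) :
    poisson ω f g ∈ M.grading ⊤ (a + b + γ) := by
  rw [add_right_comm]
  exact (hω.hamiltonian_mem hf).2.1 ⊤ b g hg

theorem IsSymplectic.contract_contract (hω : IsSymplectic ω γ) (f g : M.Fn) :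
    contract (hamiltonian ω f) (contract (hamiltonian ω g) ω) = zeroForm (poisson ω f g) := by
  rw [hω.contract_hamiltonian g]
  refine funext fun c => funext fun w => ?_
  have h : M.wordDeg w = 0 := by simp [wordDeg]
  rw [zeroForm, poisson, Vect.res_apply, Vect.apply_eq_sum _ c le_rfl, contract, h]
  refine Finset.sum_congr rfl fun I _ => ?_
  rw [twist_zero_deg, deRham_zeroForm]
  rfl

end Manifold

/-! ### The commutator of two Hamiltonian derivations -/

namespace LocallyRingedSpace

variable {n : ℕ} {S : LocallyRingedSpace.{u} n} {p N : ℕ} {deg : Fin N → Deg n}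
  (c : S.Chart (p := p) deg) {W : Opens S.carrier} {δ ε : Deg n} {D E : LocalEnd W}
  {O : Fin p ⊕ Fin N → Fin p ⊕ Fin N → S.Sec W}

local notation "⟪" I "⟫" => coordDeg deg I

theorem sgn_cases {a b : Deg n} : sgn a b = 1 ∨ sgn a b = -1 := by
  rw [sgn]; split_ifs <;> simp

theorem smul_eq_smul_sub_sub {A : Type*} [AddCommGroup A] {a b c d : ℤ} {s t : A} (h : a = d)
    (h' : b = c) : a • s = b • t - (c • t - d • s) := by
  rw [h, h', sub_sub_cancel]

theorem sub_eq_add_of_signs {A : Type*} [AddCommGroup A] {P Q R U V : A} {a b d : ℤ}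
    (ha : a = 1 ∨ a = -1) (hb : b = 1 ∨ b = -1) (hd : d = 1 ∨ d = -1)
    (h : a • Q + (a * d) • U = -((b * d) • R) + V) :
    (a * b) • P - (a * b * d) • Q = R + a • (b • P + (b * d) • (d • U - a • V)) := by
  have h' : (b * d) • (a • Q + (a * d) • U) = (b * d) • (-((b * d) • R) + V) := by rw [h]
  rcases ha with rfl | rfl <;> rcases hb with rfl | rfl <;> rcases hd with rfl | rfl <;>
    linear_combination (norm := module) -h'

/-- The commutator of a derivation with a partial derivative has the components `∂ D(x^L)/∂x^J`. -/
theorem partialDeriv_localDerivations (hW : W ≤ c.dom) (hD : D ∈ localDerivations W δ)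
    (J : Fin p ⊕ Fin N) (g : S.Sec W) :
    c.partialDeriv hW J (D ⟨W, le_rfl⟩ g) =
      ∑ L, c.partialDeriv hW J (D ⟨W, le_rfl⟩ (c.coord hW L)) * c.partialDeriv hW L g +
        sgn ⟪J⟫ δ • D ⟨W, le_rfl⟩ (c.partialDeriv hW J g) := by
  have h := localDerivations_apply c hW (commutator_mem_localDerivations
    (c.partialDerivₗ_mem_localDerivations hW J) hD) ⟨W, le_rfl⟩ g
  have h0 : ∀ (P : Prop) [Decidable P], D ⟨W, le_rfl⟩ (if P then 1 else 0) = 0 := fun P _ => by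
    split_ifs
    · exact localDerivations_one hD le_rfl
    · exact map_zero _
  simp only [LinearMap.sub_apply, LinearMap.smul_apply, LinearMap.comp_apply, res_self,
    Chart.partialDerivₗ_apply, Chart.partialDeriv_coord, h0, smul_zero, sub_zero] at h
  rw [← h, sub_add_cancel]

/-- A derivation applied to the components of `i_X ω`, where `X` has the components `x^K`. -/
theorem localDerivations_sum_twist_mul (hE : E ∈ localDerivations W ε)
    {x : Fin p ⊕ Fin N → S.Sec W} (hx : ∀ K, x K ∈ S.grading W (δ + ⟪K⟫)) (J : Fin p ⊕ Fin N) :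
    E ⟨W, le_rfl⟩ (∑ K, twist ⟪J⟫ (x K) * O J K) =
      ∑ K, (sgn ⟪J⟫ (δ + ⟪K⟫) • (E ⟨W, le_rfl⟩ (x K) * O J K) +
        (sgn ⟪J⟫ (δ + ⟪K⟫) * sgn ε (δ + ⟪K⟫)) • (x K * E ⟨W, le_rfl⟩ (O J K))) := by
  rw [map_sum]
  refine Finset.sum_congr rfl fun K _ => ?_
  rw [twist_of_mem _ (hx K), smul_mul_assoc, map_zsmul, hE.2.2 W le_rfl _ _ _ (hx K), smul_add,
    smul_smul]

theorem smul_mul_eq_smul_mul {s t : ℤ} {a b : Deg n} {x y z : S.Sec W}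
    (hx : x ∈ S.grading W a) (hy : y ∈ S.grading W b) (h : s * sgn a b = t) :
    s • (x * (y * z)) = t • (y * (x * z)) := by
  rw [← mul_assoc, S.mul_comm_sgn W a b x y hx hy, smul_mul_assoc, smul_smul, h, mul_assoc]

/-- If `i_D ω = df`, `i_E ω = dg` and `dω = 0`, then `i_{[D, E]} ω = d(D g)`. Both derivatives
`D(∂g/∂x^J)` and `E(∂f/∂x^J)` are expressed by the components of `D`, `E` and `ω`; the second one
also by means of `∂²f/∂x^J∂x^L`. The terms without derivatives of `ω` match by skew symmetry, the
other ones by closedness. -/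
theorem sum_twist_commutator_mul (hW : W ≤ c.dom) (hD : D ∈ localDerivations W δ)
    (hE : E ∈ localDerivations W ε)
    (hskew : ∀ J K, O K J = -(sgn ⟪K⟫ ⟪J⟫ • O J K))
    (hclosed : ∀ J K L, c.partialDeriv hW J (O K L) =
      sgn ⟪K⟫ ⟪J⟫ • c.partialDeriv hW K (O J L) -
        sgn ⟪L⟫ (⟪K⟫ + ⟪J⟫) • c.partialDeriv hW L (O J K))
    {f g : S.Sec W}
    (hf : ∀ J, ∑ K, twist ⟪J⟫ (D ⟨W, le_rfl⟩ (c.coord hW K)) * O J K = c.partialDeriv hW J f)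
    (hg : ∀ J, ∑ K, twist ⟪J⟫ (E ⟨W, le_rfl⟩ (c.coord hW K)) * O J K = c.partialDeriv hW J g)
    (J : Fin p ⊕ Fin N) :
    ∑ K, twist ⟪J⟫ (D ⟨W, le_rfl⟩ (E ⟨W, le_rfl⟩ (c.coord hW K)) -
        sgn δ ε • E ⟨W, le_rfl⟩ (D ⟨W, le_rfl⟩ (c.coord hW K))) * O J K =
      c.partialDeriv hW J (D ⟨W, le_rfl⟩ g) := by
  set X := D ⟨W, le_rfl⟩ with hX
  set Y := E ⟨W, le_rfl⟩ with hY
  set x := fun K => X (c.coord hW K)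
  set y := fun K => Y (c.coord hW K)
  have hx : ∀ K, x K ∈ S.grading W (δ + ⟪K⟫) := fun K => hD.2.1 W le_rfl _ _ (c.coord_mem hW K)
  have hy : ∀ K, y K ∈ S.grading W (ε + ⟪K⟫) := fun K => hE.2.1 W le_rfl _ _ (c.coord_mem hW K)
  have hXe : ∀ h, X h = ∑ L, x L * c.partialDeriv hW L h := fun h => by
    have := localDerivations_apply c hW hD ⟨W, le_rfl⟩ h
    simpa only [res_self] using this
  have hYe : ∀ h, Y h = ∑ L, y L * c.partialDeriv hW L h := fun h => by
    have := localDerivations_apply c hW hE ⟨W, le_rfl⟩ h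
    simpa only [res_self] using this
  -- the expressions for the derivatives of `∂g/∂x^J` and `∂f/∂x^J` fall into these sums
  let P := ∑ K, sgn ⟪J⟫ ⟪K⟫ • (X (y K) * O J K)
  let Q := ∑ K, sgn ⟪J⟫ ⟪K⟫ • (Y (x K) * O J K)
  let R := ∑ L, c.partialDeriv hW J (x L) * c.partialDeriv hW L g
  let U₁ := ∑ K, ∑ L, (sgn ⟪J⟫ ⟪K⟫ * sgn δ ⟪K⟫) • (y K * (x L * c.partialDeriv hW L (O J K)))
  let U₂ := ∑ K, ∑ L, (sgn ⟪J⟫ ⟪K⟫ * sgn ε ⟪K⟫) • (x K * (y L * c.partialDeriv hW L (O J K)))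
  let U₃ := ∑ K, ∑ L, (sgn ⟪J⟫ ⟪K⟫ * sgn ⟪K⟫ (δ + ⟪L⟫) * sgn ⟪J⟫ (δ + ⟪L⟫)) •
    (y K * (x L * c.partialDeriv hW J (O K L)))
  have hlhs : ∑ K, twist ⟪J⟫ (X (y K) - sgn δ ε • Y (x K)) * O J K =
      (sgn ⟪J⟫ δ * sgn ⟪J⟫ ε) • P - (sgn ⟪J⟫ δ * sgn ⟪J⟫ ε * sgn δ ε) • Q := by
    rw [Finset.smul_sum, Finset.smul_sum, ← Finset.sum_sub_distrib]
    refine Finset.sum_congr rfl fun K _ => ?_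
    have h1 : X (y K) ∈ S.grading W (δ + (ε + ⟪K⟫)) := hD.2.1 W le_rfl _ _ (hy K)
    have h2 : Y (x K) ∈ S.grading W (δ + (ε + ⟪K⟫)) := by
      rw [add_left_comm]; exact hE.2.1 W le_rfl _ _ (hx K)
    rw [twist_of_mem _ (sub_mem h1 (zsmul_mem h2 _)), smul_mul_assoc, sub_mul, smul_sub,
      smul_mul_assoc, smul_smul, smul_smul, smul_smul, sgn_add_right, sgn_add_right]
    congr 2 <;> ring
  have hrhs : c.partialDeriv hW J (X g) = R + sgn ⟪J⟫ δ • X (c.partialDeriv hW J g) :=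
    partialDeriv_localDerivations c hW hD J g
  have hXg : X (c.partialDeriv hW J g) =
      sgn ⟪J⟫ ε • P + (sgn ⟪J⟫ ε * sgn δ ε) • U₁ := by
    rw [← hg J, localDerivations_sum_twist_mul hD hy, Finset.smul_sum, Finset.smul_sum,
      ← Finset.sum_add_distrib]
    refine Finset.sum_congr rfl fun K _ => ?_
    rw [← hX, hXe (O J K), Finset.mul_sum, ← Finset.smul_sum, smul_smul, smul_smul, sgn_add_right,
      sgn_add_right]
    congr 2; ring
  have hYf : Y (c.partialDeriv hW J f) =
      sgn ⟪J⟫ δ • Q + (sgn ⟪J⟫ δ * sgn δ ε) • U₂ := by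
    rw [← hf J, localDerivations_sum_twist_mul hE hx, Finset.smul_sum, Finset.smul_sum,
      ← Finset.sum_add_distrib]
    refine Finset.sum_congr rfl fun K _ => ?_
    rw [← hY, hYe (O J K), Finset.mul_sum, ← Finset.smul_sum, smul_smul, smul_smul, sgn_add_right,
      sgn_add_right, sgn_comm ε δ]
    congr 2; ring
  have hYf' : Y (c.partialDeriv hW J f) = -((sgn ⟪J⟫ ε * sgn δ ε) • R) + U₃ := by
    -- skew symmetry of `ω` identifies the terms in `∂D(x^L)/∂x^J` with those of `∂(D g)/∂x^J`
    have hR : -((sgn ⟪J⟫ ε * sgn δ ε) • R) = ∑ K, ∑ L,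
        (sgn ⟪J⟫ ⟪K⟫ * sgn ⟪K⟫ (δ + ⟪L⟫)) • (y K * (c.partialDeriv hW J (x L) * O K L)) := by
      rw [Finset.sum_comm, Finset.smul_sum, ← Finset.sum_neg_distrib]
      refine Finset.sum_congr rfl fun L _ => ?_
      rw [← hg L, Finset.mul_sum, Finset.smul_sum, ← Finset.sum_neg_distrib]
      refine Finset.sum_congr rfl fun K _ => ?_
      rw [twist_of_mem _ (hy K), hskew L K, smul_mul_assoc, mul_smul_comm, smul_smul, mul_neg,
        mul_neg, smul_neg, neg_inj, mul_smul_comm, mul_smul_comm, smul_smul]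
      refine smul_mul_eq_smul_mul (c.partialDeriv_mem hW J (hx L)) (hy K) ?_
      simp only [sgn_eq_parity, parity_mul, dotProduct_add, dotProduct_comm]
      congr 1
      grind
    rw [hR, hYe, ← Finset.sum_add_distrib]
    refine Finset.sum_congr rfl fun K _ => ?_
    rw [c.partialDeriv_comm hW K J, ← hf K,
      show c.partialDeriv hW J (∑ L, twist ⟪K⟫ (x L) * O K L) = _ from
        localDerivations_sum_twist_mul (c.partialDerivₗ_mem_localDerivations hW J) hx K,
      mul_smul_comm, Finset.mul_sum, Finset.smul_sum, ← Finset.sum_add_distrib]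
    refine Finset.sum_congr rfl fun L _ => ?_
    simp only [mul_add, smul_add, mul_smul_comm, smul_smul, Chart.partialDerivₗ_apply]
    rw [sgn_comm ⟪K⟫ ⟪J⟫, mul_assoc]
  -- closedness of `ω`, contracted with the components of `D` and `E`
  have hU : U₁ = sgn δ ε • U₂ - sgn ⟪J⟫ δ • U₃ := by
    have h2 : U₂ = ∑ K, ∑ L, (sgn ⟪J⟫ ⟪L⟫ * sgn ε ⟪L⟫ * sgn (δ + ⟪L⟫) (ε + ⟪K⟫)) •
        (y K * (x L * c.partialDeriv hW K (O J L))) := by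
      rw [Finset.sum_comm (s := Finset.univ) (t := Finset.univ) (f := fun K L => (sgn ⟪J⟫ ⟪L⟫ *
        sgn ε ⟪L⟫ * sgn (δ + ⟪L⟫) (ε + ⟪K⟫)) • (y K * (x L * c.partialDeriv hW K (O J L))))]
      refine Finset.sum_congr rfl fun K _ => Finset.sum_congr rfl fun L _ => ?_
      exact smul_mul_eq_smul_mul (W := W) (hx K) (hy L) rfl
    rw [h2, Finset.smul_sum, Finset.smul_sum, ← Finset.sum_sub_distrib]
    refine Finset.sum_congr rfl fun K _ => ?_
    rw [Finset.smul_sum, Finset.smul_sum, ← Finset.sum_sub_distrib]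
    refine Finset.sum_congr rfl fun L _ => ?_
    rw [hclosed J K L]
    simp only [mul_sub, smul_sub, mul_smul_comm, smul_smul]
    refine smul_eq_smul_sub_sub ?_ ?_
    · simp only [sgn_eq_parity, parity_mul, dotProduct_add, dotProduct_comm]
      congr 1
      grind
    · simp only [sgn_eq_parity, parity_mul, dotProduct_add, dotProduct_comm]
      congr 1
      grind
  refine hlhs.trans ?_
  rw [hrhs, hXg, hU]
  have hQ := hYf.symm.trans hYf'
  exact sub_eq_add_of_signs sgn_cases sgn_cases sgn_cases hQ

end LocallyRingedSpace

/-! ### The Jacobi identity -/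

namespace Manifold

open LocallyRingedSpace

variable {n : ℕ} {M : Manifold.{u} n} {ω : M.LocalForms 2} {γ : Deg n}

theorem commutator_mem_derivations {δ ε : Deg n}
    {D E : (U : Opens M.carrier) → (M.Sec U →ₗ[ℝ] M.Sec U)} (hD : D ∈ M.derivations δ)
    (hE : E ∈ M.derivations ε) :
    (fun U => D U ∘ₗ E U - sgn δ ε • (E U ∘ₗ D U)) ∈ M.derivations (δ + ε) := by
  have h := commutator_mem_localDerivations (derivations_mem_localDerivations hD ⊤)
    (derivations_mem_localDerivations hE ⊤)
  exact ⟨fun U V hV f => h.1 U V le_top hV f, fun U a f hf => h.2.1 U le_top a f hf,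
    fun U a f g hf => h.2.2 U le_top a f g hf⟩

theorem IsForm.two_skew (hω : IsForm ω) (c : M.Chart) (J K : M.Idx) :
    ω c ![J, K] = -(sgn (M.idxDeg K) (M.idxDeg J) • ω c ![K, J]) := by
  have h := hω.skew c ![K, J] 0 1 rfl
  have hw : ![K, J] ∘ Equiv.swap (0 : Fin 2) 1 = ![J, K] := by
    funext i; fin_cases i <;> rfl
  rwa [hw] at h

theorem closed_two (hω : deRham ω = 0) (c : M.Chart) (J K L : M.Idx) :
    c.partialDeriv le_rfl J (ω c ![L, K]) =
      sgn (M.idxDeg K) (M.idxDeg J) • c.partialDeriv le_rfl K (ω c ![L, J]) -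
        sgn (M.idxDeg L) (M.idxDeg K + M.idxDeg J) • c.partialDeriv le_rfl L (ω c ![K, J]) := by
  have h : deRham ω c ![L, K, J] = 0 := by rw [hω]; rfl
  have h0 : ![L, K, J] ∘ Fin.succAbove 0 = ![K, J] := by funext i; fin_cases i <;> rfl
  have h1 : ![L, K, J] ∘ Fin.succAbove 1 = ![L, J] := by funext i; fin_cases i <;> rfl
  have h2 : ![L, K, J] ∘ Fin.succAbove 2 = ![L, K] := by funext i; fin_cases i <;> rfl
  have i0 : Finset.Iio (0 : Fin 3) = ∅ := by decide
  have i1 : Finset.Iio (1 : Fin 3) = {0} := by decide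
  have i2 : Finset.Iio (2 : Fin 3) = {0, 1} := by decide
  have d : ∀ I I' : M.Idx, M.wordDeg ![I, I'] = M.idxDeg I + M.idxDeg I' := fun I I' => by
    simp [wordDeg, Fin.sum_univ_two]
  have e1 : (-1) ^ ((1 : Fin 3) : ℕ) * sgn (M.idxDeg K) (M.idxDeg L) *
      sgn (M.idxDeg K) (M.idxDeg L + M.idxDeg J) = -sgn (M.idxDeg K) (M.idxDeg J) := by
    rw [sgn_add_right, Fin.val_one, pow_one]
    linear_combination (-sgn (M.idxDeg K) (M.idxDeg J)) * sgn_mul_self (M.idxDeg K) (M.idxDeg L)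
  have e2 : (-1) ^ ((2 : Fin 3) : ℕ) * (sgn (M.idxDeg J) (M.idxDeg L) *
      sgn (M.idxDeg J) (M.idxDeg K)) * sgn (M.idxDeg J) (M.idxDeg L + M.idxDeg K) = 1 := by
    rw [← sgn_add_right, mul_assoc, sgn_mul_self]
    rfl
  rw [deRham, Fin.sum_univ_three, h0, h1, h2, i0, i1, i2, Finset.prod_empty, Finset.prod_singleton,
    Finset.prod_pair (by decide), d, d, d] at h
  change (_ : ℤ) • c.partialDeriv le_rfl L (ω c ![K, J]) +
    ((-1) ^ ((1 : Fin 3) : ℕ) * sgn (M.idxDeg K) (M.idxDeg L) *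
      sgn (M.idxDeg K) (M.idxDeg L + M.idxDeg J)) • c.partialDeriv le_rfl K (ω c ![L, J]) +
    ((-1) ^ ((2 : Fin 3) : ℕ) * (sgn (M.idxDeg J) (M.idxDeg L) * sgn (M.idxDeg J) (M.idxDeg K)) *
      sgn (M.idxDeg J) (M.idxDeg L + M.idxDeg K)) • c.partialDeriv le_rfl J (ω c ![L, K]) = 0 at h
  rw [e1, e2, Fin.val_zero, pow_zero, one_mul, one_mul, one_smul] at h
  have solve : ∀ (s t : ℤ) (x y z : M.Sec c.dom), s • x + -t • y + z = 0 → z = t • y - s • x :=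
    fun s t x y z h => by linear_combination (norm := module) h
  exact solve _ _ _ _ _ h

/-- The graded commutator of `X_f` and `X_g` is the Hamiltonian vector field of `{f, g}_ω`. -/
theorem IsSymplectic.hamiltonian_poisson_apply (hω : IsSymplectic ω γ) {a b : Deg n} {f g : M.Fn}
    (hf : f ∈ M.grading ⊤ a) (hg : g ∈ M.grading ⊤ b) (h : M.Fn) :
    (hamiltonian ω (poisson ω f g)).1 ⊤ h =
      (hamiltonian ω f).1 ⊤ ((hamiltonian ω g).1 ⊤ h) -
        sgn (a + γ) (b + γ) • (hamiltonian ω g).1 ⊤ ((hamiltonian ω f).1 ⊤ h) := by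
  have hX := hω.hamiltonian_mem hf
  have hY := hω.hamiltonian_mem hg
  have hXf := contract_eq_deRham_iff.1 (hω.contract_hamiltonian f)
  have hYg := contract_eq_deRham_iff.1 (hω.contract_hamiltonian g)
  let Z : M.Vect := ⟨_, Submodule.mem_iSup_of_mem _ (commutator_mem_derivations hX hY)⟩
  have hZ : contract Z ω = deRham (zeroForm (poisson ω f g)) := by
    refine contract_eq_deRham_iff.2 fun c J => ?_
    rw [poisson, Vect.res_apply]
    exact sum_twist_commutator_mul c le_rfl (derivations_mem_localDerivations hX c.dom)
      (derivations_mem_localDerivations hY c.dom) (O := fun J K => ω c ![K, J])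
      (fun J K => hω.isForm.two_skew c J K) (fun J K L => closed_two hω.closed c J K L)
      (hXf c) (hYg c) J
  rw [← hω.eq_hamiltonian hZ]
  rfl

end Manifold

end Z2nGeometry

end

theorem mainTheorem2 {n : ℕ} (M : Z2nGeometry.Manifold.{u} n) (γ : Deg n) (ω : M.LocalForms 2)
    (hω : IsSymplectic ω γ) :
    (∀ f : M.Fn, ∃! X : M.Vect, contract X ω = deRham (zeroForm f)) ∧
    (∀ f g : M.Fn,
      contract (hamiltonian ω f) (contract (hamiltonian ω g) ω) = zeroForm (poisson ω f g)) ∧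
    (∀ (a b : Deg n) (f g : M.Fn), f ∈ M.grading ⊤ a → g ∈ M.grading ⊤ b →
      poisson ω f g ∈ M.grading ⊤ (a + b + γ)) ∧
    (∀ (a b c : Deg n) (f g h : M.Fn),
      f ∈ M.grading ⊤ a → g ∈ M.grading ⊤ b → h ∈ M.grading ⊤ c →
      poisson ω f (poisson ω g h) =
        poisson ω (poisson ω f g) h +
          sgn (a + γ) (b + γ) • poisson ω g (poisson ω f h)) := by
  refine ⟨hω.existsUnique_contract, hω.contract_contract, fun a b f g => hω.poisson_mem,
    fun a b c f g h hf hg _ => ?_⟩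
  change _ = (hamiltonian ω (poisson ω f g)).1 ⊤ h + _
  rw [hω.hamiltonian_poisson_apply hf hg]
  exact (sub_add_cancel _ _).symm
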